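/- **Model.** A nondeterministic RAM takes as input a structure $\langle [n],f\rangle$ with $[n]=\{0,\dots,n-1\}$ and $f:[n]\to[n]$. It has two accumulators $A,B$ and a main memory $R(0),R(1),\dots$, all holding natural numbers and initially $0$. A program is a finite sequence of instructions of the types $A:=n$; $A:=0$; $A:=A+1$; $A:=A-1$ (with $0-1=0$); $\mathrm{guess}(A)$ (put any natural number into $A$); $A:=f(B)$ (the machine is stuck if $B\ge n$); $A:=R(A)$; $B:=A$; $R(A):=B$; if $A=B$ then goto $i_0$ else goto $i_1$; accept (only as the last instruction); reject. A problem (a set of instances, coded as such structures, and a question) is in $\mathrm{NTISP}(T(n),S(n))$ if there are such a program and functions $t=O(T(n))$, $s=O(S(n))$, $m=O(\max\{n,S(n)\})$ such that on every instance $\langle[n],f\rangle$ every computation performs at most $t(n)$ steps, accesses only memory registers with addresses at most $s(n)$, and keeps the contents of all memory registers at most $m(n)$, and some computation accepts if and only if the answer to the question is "yes". **Separating trees.** Let $c$ be a real number and $G=(V,E)$ a graph with vertex set $V=\{0,\dots,N-1\}$. A separating tree of $G$ (with leaf constant $c$) is a binary tree whose nodes are (listed) subsets partitioning $V$, such that every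 leaf has at most $c\sqrt N$ vertices and, for every inner node $C$, if $A$ and $B$ are the sets of vertices in its left and right subtrees and $m=|A|+|B|+|C|$, then $m>0$, $|C|\le 2\sqrt2\sqrt m$, $|A|,|B|\le 2m/3$, and no edge of $G$ joins $A$ to $B$. The separating tree representation of $G$ is the following sequence of numbers. The nodes are listed in preorder; a node contributes $0$ (leaf) or $1$ (inner node), then its number of vertices, and then for each of its vertices $v$ the number of neighbours of $v$ among the vertices preceding $v$ on the branch from the root (those in ancestor nodes and those before $v$ in its own node), followed by the positions (counted from $0$, increasing) of these neighbours in the list of vertices of the branch. A sequence of $n$ numbers smaller than $n$ is identified with the structure $\langle[n],f\rangle$ whose values $f(0),\dots,f(n-1)$ it lists. **Problems.** *Separating Tree Planar 3-Colourability*: the instance is a planar graph $G$ in the separating tree representation given by some separating tree with leaf constant $c$; is $G$ 3-colourable? *Separating Tree Planar Vertex Cover*: the instance is an integer $k$ with $0\le k\le|V|$ followed by a planar graph $G=(V,E)$ in such a representation; does $G$ have a vertex cover of at most $k$ vertices? **Proposition.** For every constant $c$, Separating Tree Planar 3-Colourability and Separating Tree Planar Vertex Cover are in $\mathrm{NTISP}(n,\sqrt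 n)$. -/

import Mathlib

open Filter Asymptotics

/-! ## Nondeterministic random access machines on unary structures `⟨[n], f⟩`

The input is a structure with domain `[n] = {0, …, n - 1}` and one unary function
`f : [n] → [n]`.  As the signature has arity `1`, the machine has the two accumulators `A`, `B`
(where `B` is `B₁`), and the main memory `R₀, R₁, …`. -/

/-- The instruction set. Instructions are numbered from `0`. -/
inductive Instr where
  /-- `A := L`, the register `L` holding `n` -/
  | loadLen
  /-- `A := 0` -/
  | zero
  /-- `A := A + 1` -/
  | inc
  /-- `A := A - 1` (with `0 - 1 = 0`) -/
  | dec
  /-- `guess(A)`: any natural number is put into `A` -/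
  | guess
  /-- `A := f(B)`; there is no input register `f(B)` if `B ≥ n`, and then the machine is stuck -/
  | query
  /-- `A := R(A)` -/
  | load
  /-- `B := A` -/
  | copy
  /-- `R(A) := B` -/
  | store
  /-- `if A = B then goto i₀ else goto i₁` -/
  | branch (i₀ i₁ : ℕ)
  | accept
  | reject

/-- A program; `accept` occurs as its last instruction and nowhere else. -/
structure NRAM where
  code : List Instr
  accept_iff : ∀ i, code[i]? = some Instr.accept ↔ i + 1 = code.length

/-- A configuration of a machine: instruction counter, accumulators, main memory. -/
structure Config where
  pc : ℕ
  A : ℕ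
  B : ℕ
  mem : ℕ → ℕ

/-- At the beginning everything is `0` and the first instruction is the current one. -/
def Config.init : Config := ⟨0, 0, 0, fun _ => 0⟩

namespace NRAM

/-- `M.Step f c c'`: on input `f`, executing one instruction in `c` may lead to `c'`.
`accept` and `reject` stop the computation. -/
def Step (M : NRAM) {n : ℕ} (f : Fin n → Fin n) (c c' : Config) : Prop :=
  match M.code[c.pc]? with
  | some .loadLen => c' = { c with pc := c.pc + 1, A := n }
  | some .zero => c' = { c with pc := c.pc + 1, A := 0 }
  | some .inc => c' = { c with pc := c.pc + 1, A := c.A + 1 }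
  | some .dec => c' = { c with pc := c.pc + 1, A := c.A - 1 }
  | some .guess => ∃ x : ℕ, c' = { c with pc := c.pc + 1, A := x }
  | some .query => ∃ h : c.B < n, c' = { c with pc := c.pc + 1, A := (f ⟨c.B, h⟩ : ℕ) }
  | some .load => c' = { c with pc := c.pc + 1, A := c.mem c.A }
  | some .copy => c' = { c with pc := c.pc + 1, B := c.A }
  | some .store => c' = { c with pc := c.pc + 1, mem := Function.update c.mem c.A c.B }
  | some (.branch i₀ i₁) => c' = { c with pc := if c.A = c.B then i₀ else i₁ }
  | some .accept => False
  | some .reject => False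
  | none => False

/-- `M.ReachIn f k c`: some computation on input `f` is in configuration `c` after `k` steps. -/
inductive ReachIn (M : NRAM) {n : ℕ} (f : Fin n → Fin n) : ℕ → Config → Prop
  | start : ReachIn M f 0 Config.init
  | step {k : ℕ} {c c' : Config} :
      ReachIn M f k c → M.Step f c c' → ReachIn M f (k + 1) c'

/-- Some computation on input `f` arrives at the instruction `accept`. -/
def Accepts (M : NRAM) {n : ℕ} (f : Fin n → Fin n) : Prop :=
  ∃ k c, M.ReachIn f k c ∧ M.code[c.pc]? = some Instr.accept

/-- No computation on input `f` performs more than `t` steps. -/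
def RunsInTime (M : NRAM) {n : ℕ} (f : Fin n → Fin n) (t : ℕ) : Prop :=
  ∀ k c, M.ReachIn f k c → k ≤ t

/-- Every computation on input `f` reads and writes only registers of the main memory with
address at most `s`, and their contents are always at most `m`. -/
def RunsInSpace (M : NRAM) {n : ℕ} (f : Fin n → Fin n) (s m : ℕ) : Prop :=
  ∀ k c, M.ReachIn f k c →
    (M.code[c.pc]? = some Instr.load ∨ M.code[c.pc]? = some Instr.store → c.A ≤ s) ∧
    ∀ a, c.mem a ≤ m

end NRAM

/-- A decision problem over unary structures: the structures that are (codes of) instances, and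
those for which the answer to the question is "yes". -/
structure UnaryProblem where
  IsInstance : ∀ {n : ℕ}, (Fin n → Fin n) → Prop
  IsYes : ∀ {n : ℕ}, (Fin n → Fin n) → Prop

/-- The class `NTISP(T(n), S(n))`: problems decided, on all their instances, by a nondeterministic
RAM that performs `O(T(n))` instructions and uses registers of the main memory with addresses
`O(S(n))` and contents `O(max {n, S(n)})`, where `n` is the size of the domain of the input. -/
def NTISP (T S : ℕ → ℝ) : Set UnaryProblem :=
  {P | ∃ (M : NRAM) (t s m : ℕ → ℕ),
    (fun n => (t n : ℝ)) =O[atTop] T ∧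
    (fun n => (s n : ℝ)) =O[atTop] S ∧
    (fun n => (m n : ℝ)) =O[atTop] (fun n => max (n : ℝ) (S n)) ∧
    ∀ (n : ℕ) (f : Fin n → Fin n), P.IsInstance f →
      M.RunsInTime f (t n) ∧ M.RunsInSpace f (s n) (m n) ∧ (M.Accepts f ↔ P.IsYes f)}

/-! ## Planar graphs -/

/-- `G` can be drawn in the plane: vertices are distinct points, edges are simple arcs joining
their ends, an arc contains no vertices but its ends, and the arcs of two different edges meet
only in vertices. -/
def IsPlanar {V : Type} (G : SimpleGraph V) : Prop :=
  ∃ (pt : V → EuclideanSpace ℝ (Fin 2)) (arc : ∀ u v, G.Adj u v → Path (pt u) (pt v)),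
    Function.Injective pt ∧
    (∀ u v h, Function.Injective (arc u v h)) ∧
    (∀ u v h x t, arc u v h t = pt x → x = u ∨ x = v) ∧
    (∀ u v h u' v' h', s(u, v) ≠ s(u', v') →
      ∀ t t', arc u v h t = arc u' v' h' t' → ∃ x, arc u v h t = pt x)

/-! ## Separating trees -/

/-- Binary trees whose nodes carry lists of vertices. -/
inductive SepTree (V : Type) where
  | leaf (E : List V) : SepTree V
  | node (E : List V) (l r : SepTree V) : SepTree V

namespace SepTree

variable {V : Type}

/-- All vertices in the nodes of the tree. -/
def verts : SepTree V → List V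
  | leaf E => E
  | node E l r => E ++ l.verts ++ r.verts

/-- The recursive separation: a leaf has at most `b` vertices. In an inner node, the nonempty
set of the `m` vertices of the subtree is divided into the separator `C = E` and the sets `A`, `B`
of the vertices of the two subtrees, where `|C| ≤ 2√2√m`, `|A|, |B| ≤ 2m/3` and no edge joins `A`
to `B`. -/
def Separates (G : SimpleGraph V) (b : ℝ) : SepTree V → Prop
  | leaf E => (E.length : ℝ) ≤ b
  | node E l r =>
      let m : ℕ := (node E l r).verts.length
      0 < m ∧
      (E.length : ℝ) ≤ 2 * √2 * √(m : ℝ) ∧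
      (l.verts.length : ℝ) ≤ 2 * (m : ℝ) / 3 ∧
      (r.verts.length : ℝ) ≤ 2 * (m : ℝ) / 3 ∧
      (∀ u ∈ l.verts, ∀ v ∈ r.verts, ¬ G.Adj u v) ∧
      l.Separates G b ∧ r.Separates G b

/-- `T` is a separating tree of the graph `G` with `N` vertices, with leaves of size at most
`c√N`: the nodes form a partition of the vertices, obtained by recursive separation. -/
def IsSeparatingTree {N : ℕ} (T : SepTree (Fin N)) (G : SimpleGraph (Fin N)) (c : ℝ) : Prop :=
  T.verts.Nodup ∧ (∀ v, v ∈ T.verts) ∧ T.Separates G (c * √(N : ℝ))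

/-! ### The separating tree representation of a graph

The nodes are listed in preorder, each with a mark (`0` for a leaf, `1` for an inner node) and its
number of vertices. For each vertex `v` of the node there is the list, with its length in front, of
the neighbours of `v` among the vertices that precede `v` on the branch (those in the ancestors of
the node and those before `v` in the node), each named by its position on the branch. As every edge
joins two vertices on the same branch, this describes the graph, every edge being listed once. -/

open Classical in
/-- The positions of the neighbours of `v` in the list `p`, in increasing order. -/
noncomputable def nbrPositions (G : SimpleGraph V) (p : List V) (v : V) : List ℕ :=
  (List.range p.length).filter (fun i => ∃ u, p[i]? = some u ∧ G.Adj u v)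

/-- The entries for the vertices of a list, where `p` is the part of the branch before it. -/
noncomputable def encodeVerts (G : SimpleGraph V) : List V → List V → List ℕ
  | _, [] => []
  | p, v :: vs =>
      (nbrPositions G p v).length :: (nbrPositions G p v ++ encodeVerts G (p ++ [v]) vs)

/-- The code of a subtree, where `p` lists the vertices of the ancestors of its root. -/
noncomputable def encode (G : SimpleGraph V) : List V → SepTree V → List ℕ
  | p, leaf E => 0 :: E.length :: encodeVerts G p E
  | p, node E l r =>
      1 :: E.length :: (encodeVerts G p E ++ encode G (p ++ E) l ++ encode G (p ++ E) r)

end SepTree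

/-- The structure `⟨[n], f⟩` is the sequence `w` of `n` numbers smaller than `n`. -/
def IsCodedBy {n : ℕ} (f : Fin n → Fin n) (w : List ℕ) : Prop :=
  List.ofFn (fun i => (f i : ℕ)) = w

/-- **Separating Tree Planar 3-Colourability**, where leaves have at most `c√|V|` vertices.
Instance: a planar graph in separating tree representation. Question: is it 3-colourable? -/
def sepTreePlanar3Col (c : ℝ) : UnaryProblem where
  IsInstance f := ∃ (N : ℕ) (G : SimpleGraph (Fin N)) (T : SepTree (Fin N)),
    IsPlanar G ∧ T.IsSeparatingTree G c ∧ IsCodedBy f (T.encode G [])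
  IsYes f := ∃ (N : ℕ) (G : SimpleGraph (Fin N)) (T : SepTree (Fin N)),
    IsPlanar G ∧ T.IsSeparatingTree G c ∧ IsCodedBy f (T.encode G []) ∧ G.Colorable 3

/-- **Separating Tree Planar Vertex Cover**, where leaves have at most `c√|V|` vertices.
Instance: a planar graph in separating tree representation, preceded by an integer `k ≤ |V|`.
Question: does the graph have a vertex cover of at most `k` vertices? -/
def sepTreePlanarVertexCover (c : ℝ) : UnaryProblem where
  IsInstance f := ∃ (N : ℕ) (G : SimpleGraph (Fin N)) (T : SepTree (Fin N)) (k : ℕ),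
    k ≤ N ∧ IsPlanar G ∧ T.IsSeparatingTree G c ∧ IsCodedBy f (k :: T.encode G [])
  IsYes f := ∃ (N : ℕ) (G : SimpleGraph (Fin N)) (T : SepTree (Fin N)) (k : ℕ),
    k ≤ N ∧ IsPlanar G ∧ T.IsSeparatingTree G c ∧ IsCodedBy f (k :: T.encode G []) ∧
      ∃ C : Finset (Fin N), G.IsVertexCover (C : Set (Fin N)) ∧ C.card ≤ k

/-! A separating tree lets both questions be decided by a depth-first walk that remembers only the
current branch. No edge joins the two subtrees below an inner node, so both ends of an edge lie on
one branch, and the edge is listed at the later end. On reading a vertex, the machine guesses a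
label and compares it with the stored labels of the listed neighbours; the labels of a subtree may
be forgotten once the walk leaves it. Each entry of the input is read once at constant cost, so the
time is linear.

The space is governed by the longest branch. Subtree sizes shrink by the factor `2/3` per level and
separators have size `O(√m)`, so a branch is a geometric series of separators followed by one leaf,
`O(√N)` vertices in all (`SepTree.height_le`). The stack for returning to right subtrees has at most
one entry per inner node of the branch.

Both questions are instances of one labelling problem (`extendTree_iff`): there are `q` free labels,
which adjacent vertices must not share, and a paid state, which costs one unit of a budget and
conflicts with nothing. Three free labels and budget `0` give 3-colourings; with one free label the
paid vertices form a vertex cover. Numbering the paid label by the position on the branch makes it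
differ from all others, so a single inequality test serves both cases.

The machine is treated by a program logic in continuation form: `Runs` bounds all computations from
a configuration and characterizes acceptance by a proposition. Rules for RAM instructions yield
rules for a small register language, in which `runs_tree` matches the program with `ExtendTree` by
induction on the tree. -/

namespace NRAM

/-! ### Program logic for the RAM. -/

section Runs

variable {M : NRAM} {n : ℕ} {f : Fin n → Fin n} {s m : ℕ}

/-- `c` respects the bound `s` on addresses and the bound `m` on the contents of registers. -/
def Fits (M : NRAM) (s m : ℕ) (c : Config) : Prop :=
  (M.code[c.pc]? = some Instr.load ∨ M.code[c.pc]? = some Instr.store → c.A ≤ s) ∧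
    ∀ a, c.mem a ≤ m

/-- Some computation leads from `c` to `c'` in `k` steps. -/
def Steps (M : NRAM) {n : ℕ} (f : Fin n → Fin n) : ℕ → Config → Config → Prop
  | 0, c, c' => c = c'
  | k + 1, c, c' => ∃ d, M.Step f c d ∧ Steps M f k d c'

theorem Steps.snoc {k : ℕ} {c d e : Config} (h : M.Steps f k c d) (h' : M.Step f d e) :
    M.Steps f (k + 1) c e := by
  induction k generalizing c with
  | zero => cases h; exact ⟨e, h', rfl⟩
  | succ k ih => obtain ⟨x, hx, h⟩ := h; exact ⟨x, hx, ih h⟩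

theorem ReachIn.of_steps {j k : ℕ} {c d : Config} (hj : M.ReachIn f j c)
    (h : M.Steps f k c d) : M.ReachIn f (j + k) d := by
  induction k generalizing c j with
  | zero => cases h; exact hj
  | succ k ih =>
    obtain ⟨x, hx, h⟩ := h
    have := ih (hj.step hx) h
    rwa [Nat.add_right_comm] at this

theorem reachIn_iff {k : ℕ} {c : Config} :
    M.ReachIn f k c ↔ M.Steps f k Config.init c := by
  refine ⟨fun h => ?_, fun h => ?_⟩
  · induction h with
    | start => rfl
    | step _ hs ih => exact ih.snoc hs
  · simpa using ReachIn.of_steps .start h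

/-- From `c`, if its memory is bounded by `m`, every computation performs at most `T` steps and
stays within the space bounds, and some computation accepts if and only if `P` holds. -/
def Runs (M : NRAM) {n : ℕ} (f : Fin n → Fin n) (s m : ℕ) (c : Config) (T : ℕ) (P : Prop) : Prop :=
  (∀ a, c.mem a ≤ m) →
    (∀ k c', M.Steps f k c c' → k ≤ T ∧ M.Fits s m c') ∧
    ((∃ k c', M.Steps f k c c' ∧ M.code[c'.pc]? = some Instr.accept) ↔ P)

theorem Runs.mono {c : Config} {T T' : ℕ} {P : Prop} (h : M.Runs f s m c T P) (hT : T ≤ T') :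
    M.Runs f s m c T' P := fun hb =>
  ⟨fun k c' hk => ⟨((h hb).1 k c' hk).1.trans hT, ((h hb).1 k c' hk).2⟩, (h hb).2⟩

/-- A computation from `c` is empty or starts with a step to a successor: the bounds are needed at
every successor, whereas acceptance is a disjunction over them. -/
theorem Runs.of_step {c : Config} {T : ℕ} {P : Config → Prop}
    (ha : M.code[c.pc]? = some Instr.load ∨ M.code[c.pc]? = some Instr.store → c.A ≤ s)
    (hacc : M.code[c.pc]? ≠ some Instr.accept)
    (h : ∀ d, M.Step f c d → M.Runs f s m d T (P d))
    (hbd : ∀ d, M.Step f c d → (∀ a, c.mem a ≤ m) → ∀ a, d.mem a ≤ m) :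
    M.Runs f s m c (T + 1) (∃ d, M.Step f c d ∧ P d) := by
  intro hb
  refine ⟨?_, ?_⟩
  · rintro (_ | k) c' hk
    · cases hk
      exact ⟨by omega, ha, hb⟩
    · obtain ⟨d, hd, hk⟩ := hk
      have := (h d hd (hbd d hd hb)).1 k c' hk
      exact ⟨by omega, this.2⟩
  · constructor
    · rintro ⟨_ | k, c', hk, hc⟩
      · cases hk; exact absurd hc hacc
      · obtain ⟨d, hd, hk⟩ := hk
        exact ⟨d, hd, (h d hd (hbd d hd hb)).2.1 ⟨k, c', hk, hc⟩⟩
    · rintro ⟨d, hd, hP⟩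
      obtain ⟨k, c', hk, hc⟩ := (h d hd (hbd d hd hb)).2.2 hP
      exact ⟨k + 1, c', ⟨d, hd, hk⟩, hc⟩

theorem Runs.of_step_iff {c d : Config} {T : ℕ} {P : Prop}
    (ha : M.code[c.pc]? = some Instr.load ∨ M.code[c.pc]? = some Instr.store → c.A ≤ s)
    (hstep : ∀ e, M.Step f c e ↔ e = d)
    (hbd : (∀ a, c.mem a ≤ m) → ∀ a, d.mem a ≤ m)
    (h : M.Runs f s m d T P) : M.Runs f s m c (T + 1) P := by
  -- No step is possible at `accept`, but `d` is a successor of `c`.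
  have hacc : M.code[c.pc]? ≠ some Instr.accept := fun he => by
    have := (hstep d).2 rfl
    simp [Step, he] at this
  have := Runs.of_step (P := fun _ => P) ha hacc (fun e he => (hstep e).1 he ▸ h)
    (fun e he => (hstep e).1 he ▸ hbd)
  simpa [hstep] using this

/-- The code of `M` contains the block `l` at the address `o`. -/
def CodeAt (M : NRAM) (o : ℕ) (l : List Instr) : Prop :=
  ∀ j x, l[j]? = some x → M.code[o + j]? = some x

theorem CodeAt.head {o : ℕ} {x : Instr} {l : List Instr} (h : M.CodeAt o (x :: l)) :
    M.code[o]? = some x := h 0 x rfl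

theorem CodeAt.left {o : ℕ} {l l' : List Instr} (h : M.CodeAt o (l ++ l')) : M.CodeAt o l :=
  fun j x hx => h j x (by
    rw [List.getElem?_append_left (List.getElem?_eq_some_iff.1 hx).1, hx])

theorem CodeAt.right {o : ℕ} {l l' : List Instr} (h : M.CodeAt o (l ++ l')) :
    M.CodeAt (o + l.length) l' := fun j x hx => by
  rw [Nat.add_assoc]
  exact h _ x (by rw [List.getElem?_append_right (by omega)]; simpa using hx)

/-- The straight-line block `l` turns the accumulators and the memory from `x` into `y`. -/
def Block (M : NRAM) {n : ℕ} (f : Fin n → Fin n) (s m : ℕ) (l : List Instr)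
    (x y : ℕ × ℕ × (ℕ → ℕ)) : Prop :=
  ∀ o T P, M.CodeAt o l → M.Runs f s m ⟨o + l.length, y.1, y.2.1, y.2.2⟩ T P →
    M.Runs f s m ⟨o, x.1, x.2.1, x.2.2⟩ (T + l.length) P

theorem Block.append {l l' : List Instr} {x y z : ℕ × ℕ × (ℕ → ℕ)}
    (h : M.Block f s m l x y) (h' : M.Block f s m l' y z) : M.Block f s m (l ++ l') x z := by
  intro o T P hc hr
  have := h o _ P hc.left (h' _ T P hc.right (by simpa [Nat.add_assoc] using hr))
  exact this.mono (by simp; omega)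

theorem Block.nil {x : ℕ × ℕ × (ℕ → ℕ)} : M.Block f s m [] x x := fun _ _ _ _ h => h

theorem Block.loadLen {A B : ℕ} {μ : ℕ → ℕ} :
    M.Block f s m [.loadLen] (A, B, μ) (n, B, μ) := fun o T P hc hr =>
  Runs.of_step_iff (by simp [hc.head]) (fun e => by simp [Step, hc.head]) (fun h => by exact h) hr

theorem Block.zero {A B : ℕ} {μ : ℕ → ℕ} :
    M.Block f s m [.zero] (A, B, μ) (0, B, μ) := fun o T P hc hr =>
  Runs.of_step_iff (by simp [hc.head]) (fun e => by simp [Step, hc.head]) (fun h => by exact h) hr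

theorem Block.inc {A B : ℕ} {μ : ℕ → ℕ} :
    M.Block f s m [.inc] (A, B, μ) (A + 1, B, μ) := fun o T P hc hr =>
  Runs.of_step_iff (by simp [hc.head]) (fun e => by simp [Step, hc.head]) (fun h => by exact h) hr

theorem Block.dec {A B : ℕ} {μ : ℕ → ℕ} :
    M.Block f s m [.dec] (A, B, μ) (A - 1, B, μ) := fun o T P hc hr =>
  Runs.of_step_iff (by simp [hc.head]) (fun e => by simp [Step, hc.head]) (fun h => by exact h) hr

theorem Block.copy {A B : ℕ} {μ : ℕ → ℕ} :
    M.Block f s m [.copy] (A, B, μ) (A, A, μ) := fun o T P hc hr =>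
  Runs.of_step_iff (by simp [hc.head]) (fun e => by simp [Step, hc.head]) (fun h => by exact h) hr

theorem Block.query {A B : ℕ} {μ : ℕ → ℕ} (h : B < n) :
    M.Block f s m [.query] (A, B, μ) (f ⟨B, h⟩, B, μ) := fun o T P hc hr =>
  Runs.of_step_iff (by simp [hc.head]) (fun e => by simp [Step, hc.head, h]) (fun h => by exact h) hr

theorem Block.load {A B : ℕ} {μ : ℕ → ℕ} (h : A ≤ s) :
    M.Block f s m [.load] (A, B, μ) (μ A, B, μ) := fun o T P hc hr =>
  Runs.of_step_iff (fun _ => h) (fun e => by simp [Step, hc.head]) (fun h => by exact h) hr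

theorem Block.store {A B : ℕ} {μ : ℕ → ℕ} (h : A ≤ s) (hB : B ≤ m) :
    M.Block f s m [.store] (A, B, μ) (A, B, Function.update μ A B) := fun o T P hc hr =>
  Runs.of_step_iff (fun _ => h) (fun e => by simp [Step, hc.head])
    (fun h a => by
      rcases eq_or_ne a A with rfl | ha
      · simpa using hB
      · simpa [ha] using h a) hr

theorem Block.incs {A B : ℕ} {μ : ℕ → ℕ} (k : ℕ) :
    M.Block f s m (List.replicate k .inc) (A, B, μ) (A + k, B, μ) := by
  induction k with
  | zero => exact Block.nil
  | succ k ih => rw [List.replicate_succ']; exact ih.append Block.inc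

theorem Runs.branch {o A B i₀ i₁ T : ℕ} {μ : ℕ → ℕ} {P : Prop} (hc : M.CodeAt o [.branch i₀ i₁])
    (h : M.Runs f s m ⟨if A = B then i₀ else i₁, A, B, μ⟩ T P) :
    M.Runs f s m ⟨o, A, B, μ⟩ (T + 1) P :=
  Runs.of_step_iff (by simp [hc.head]) (fun e => by simp [Step, hc.head]) (fun h => by exact h) h

/-- The guessed number enters only the accumulator, so arbitrarily large guesses do not violate the
bound on memory contents. -/
theorem Runs.guess {o A B T : ℕ} {μ : ℕ → ℕ} {P : ℕ → Prop} (hc : M.CodeAt o [.guess])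
    (h : ∀ x, M.Runs f s m ⟨o + 1, x, B, μ⟩ T (P x)) :
    M.Runs f s m ⟨o, A, B, μ⟩ (T + 1) (∃ x, P x) := by
  have := Runs.of_step (M := M) (f := f) (s := s) (m := m) (c := ⟨o, A, B, μ⟩) (T := T)
    (P := fun d => P d.A)
    (by simp [hc.head]) (by simp [hc.head])
    (by
      intro d hd
      obtain ⟨x, rfl⟩ : ∃ x, d = ⟨o + 1, x, B, μ⟩ := by simpa [Step, hc.head] using hd
      exact h x)
    (by
      intro d hd
      obtain ⟨x, rfl⟩ : ∃ x, d = ⟨o + 1, x, B, μ⟩ := by simpa [Step, hc.head] using hd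
      exact fun h => h)
  refine cast ?_ this
  congr 1
  simp only [Step, hc.head, eq_iff_iff]
  constructor
  · rintro ⟨d, ⟨x, rfl⟩, hx⟩; exact ⟨x, hx⟩
  · rintro ⟨x, hx⟩; exact ⟨_, ⟨x, rfl⟩, hx⟩

theorem Runs.accept {o A B : ℕ} {μ : ℕ → ℕ} (hc : M.CodeAt o [.accept]) :
    M.Runs f s m ⟨o, A, B, μ⟩ 0 True := by
  intro hb
  have hs : ∀ k c', M.Steps f k ⟨o, A, B, μ⟩ c' → k = 0 ∧ c' = ⟨o, A, B, μ⟩ := by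
    rintro (_ | k) c' hk
    · exact ⟨rfl, hk.symm⟩
    · obtain ⟨d, hd, -⟩ := hk
      simp [Step, hc.head] at hd
  refine ⟨fun k c' hk => ?_, fun _ => trivial, fun _ => ⟨0, _, rfl, hc.head⟩⟩
  obtain ⟨rfl, rfl⟩ := hs k c' hk
  exact ⟨le_rfl, by simp [hc.head], hb⟩

theorem Runs.reject {o A B : ℕ} {μ : ℕ → ℕ} (hc : M.CodeAt o [.reject]) :
    M.Runs f s m ⟨o, A, B, μ⟩ 0 False := by
  intro hb
  have hs : ∀ k c', M.Steps f k ⟨o, A, B, μ⟩ c' → k = 0 ∧ c' = ⟨o, A, B, μ⟩ := by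
    rintro (_ | k) c' hk
    · exact ⟨rfl, hk.symm⟩
    · obtain ⟨d, hd, -⟩ := hk
      simp [Step, hc.head] at hd
  refine ⟨fun k c' hk => ?_, ?_, False.elim⟩
  · obtain ⟨rfl, rfl⟩ := hs k c' hk
    exact ⟨le_rfl, by simp [hc.head], hb⟩
  · rintro ⟨k, c', hk, h⟩
    obtain ⟨rfl, rfl⟩ := hs k c' hk
    simp [hc.head] at h

theorem Runs.bounds {T : ℕ} {P : Prop} (h : M.Runs f s m Config.init T P) :
    M.RunsInTime f T ∧ M.RunsInSpace f s m ∧ (M.Accepts f ↔ P) := by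
  have h := h (fun _ => Nat.zero_le _)
  simp only [RunsInTime, RunsInSpace, Accepts, reachIn_iff]
  exact ⟨fun k c hk => (h.1 k c hk).1, fun k c hk => (h.1 k c hk).2, h.2⟩

end Runs

end NRAM

/-! ## Register programs -/

/-- Instructions for a machine with `w` registers and a heap. -/
inductive RegInstr (w : ℕ) where
  | zero (r : Fin w)
  | add (r : Fin w) (k : ℕ)
  | dec (r : Fin w)
  | move (r q : Fin w)
  | len (r : Fin w)
  /-- read the input value with the index in `q` -/
  | query (r q : Fin w)
  /-- load `r` from the heap address in `q` -/
  | get (r q : Fin w)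
  /-- store `q` to the heap address in `r` -/
  | put (r q : Fin w)
  | jump (r q : Fin w) (i₀ i₁ : ℕ)
  | choose (i₀ i₁ : ℕ)
  | reject
  | accept

namespace RegInstr

variable {w : ℕ}

/-- `A := R(r)` -/
def loadReg (r : Fin w) : List Instr := [.zero] ++ List.replicate r .inc ++ [.load]

/-- `R(r) := A` -/
def storeReg (r : Fin w) : List Instr :=
  [.copy] ++ [.zero] ++ List.replicate r .inc ++ [.store]

/-- Translation into RAM instructions, where `σ` gives the addresses of the jump targets. -/
def compile (σ : ℕ → ℕ) : RegInstr w → List Instr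
  | zero r => [.zero] ++ storeReg r
  | add r k => loadReg r ++ List.replicate k .inc ++ storeReg r
  | dec r => loadReg r ++ [.dec] ++ storeReg r
  | move r q => loadReg q ++ storeReg r
  | len r => [.loadLen] ++ storeReg r
  | query r q => loadReg q ++ [.copy] ++ [.query] ++ storeReg r
  | get r q => loadReg q ++ List.replicate w .inc ++ [.load] ++ storeReg r
  | put r q => loadReg q ++ [.copy] ++ loadReg r ++ List.replicate w .inc ++ [.store]
  | jump r q i₀ i₁ => loadReg r ++ [.copy] ++ loadReg q ++ [.branch (σ i₀) (σ i₁)]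
  | choose i₀ i₁ => [.zero] ++ [.copy] ++ [.guess] ++ [.branch (σ i₀) (σ i₁)]
  | reject => [.reject]
  | accept => [.accept]

/-- The number of RAM instructions needed. -/
def size (x : RegInstr w) : ℕ := (x.compile id).length

/-- Jump targets are operands, so code length does not depend on `σ`. This lets `offset` be computed
from `size` before any code is generated. -/
theorem length_compile (σ : ℕ → ℕ) (x : RegInstr w) : (x.compile σ).length = x.size := by
  cases x <;> simp [compile, size]

/-- The address of the `i`-th instruction of a program. -/
def offset (prog : List (RegInstr w)) (i : ℕ) : ℕ := ((prog.take i).map size).sum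

/-- The RAM code of a register program. -/
def code (prog : List (RegInstr w)) : List Instr := prog.flatMap (compile (offset prog))

theorem length_flatMap_compile (σ : ℕ → ℕ) (l : List (RegInstr w)) :
    (l.flatMap (compile σ)).length = (l.map size).sum := by
  simp [List.length_flatMap, length_compile]

theorem accept_notMem_compile (σ : ℕ → ℕ) (x : RegInstr w) (hx : x ≠ accept) :
    Instr.accept ∉ x.compile σ := by
  cases x <;> simp_all [compile, loadReg, storeReg, List.mem_replicate]

/-- The RAM executing a register program. -/
def toNRAM (body : List (RegInstr w)) (h : accept ∉ body) : NRAM where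
  code := code (body ++ [accept])
  accept_iff i := by
    have hb : Instr.accept ∉ body.flatMap (compile (offset (body ++ [accept]))) := by
      simp only [List.mem_flatMap, not_exists, not_and]
      exact fun x hx => accept_notMem_compile _ x (fun he => h (he ▸ hx))
    have : code (body ++ [accept]) =
        body.flatMap (compile (offset (body ++ [accept]))) ++ [Instr.accept] := by
      simp [code, compile]
    rw [this]
    generalize body.flatMap _ = l at hb
    rw [List.length_append, List.length_singleton, Nat.add_right_cancel_iff]
    constructor
    · intro hi
      rcases lt_or_ge i l.length with h | h
      · rw [List.getElem?_append_left h] at hi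
        exact absurd (List.mem_of_getElem? hi) hb
      · have := (List.getElem?_eq_some_iff.1 hi).1
        simp at this; omega
    · rintro rfl; simp

theorem codeAt {body : List (RegInstr w)} {h : accept ∉ body} {i : ℕ} {x : RegInstr w}
    (hx : (body ++ [accept])[i]? = some x) :
    (toNRAM body h).CodeAt (offset (body ++ [accept]) i)
      (x.compile (offset (body ++ [accept]))) := by
  intro j y hy
  change (code (body ++ [accept]))[_]? = _
  generalize body ++ [accept] = prog at *
  have hsplit : prog = prog.take i ++ (x :: prog.drop (i + 1)) := by
    obtain ⟨hi, rfl⟩ := List.getElem?_eq_some_iff.1 hx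
    rw [List.cons_getElem_drop_succ, List.take_append_drop]
  have hcode (σ : ℕ → ℕ) : prog.flatMap (compile σ) = (prog.take i).flatMap (compile σ) ++
      (x.compile σ ++ (prog.drop (i + 1)).flatMap (compile σ)) := by
    conv_lhs => rw [hsplit]
    rw [List.flatMap_append, List.flatMap_cons]
  have hlen : ((prog.take i).flatMap (compile (offset prog))).length = offset prog i :=
    length_flatMap_compile _ _
  rw [code, hcode, List.getElem?_append_right (by omega), hlen, Nat.add_sub_cancel_left,
    List.getElem?_append_left (List.getElem?_eq_some_iff.1 hy).1, hy]

theorem offset_succ {prog : List (RegInstr w)} {i : ℕ} {x : RegInstr w}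
    (hx : prog[i]? = some x) : offset prog (i + 1) = offset prog i + x.size := by
  simp [offset, List.take_add_one, hx]

/-- The memory with the contents `ρ` of the registers and `η` of the heap. -/
def memory (ρ : Fin w → ℕ) (η : ℕ → ℕ) (a : ℕ) : ℕ :=
  if h : a < w then ρ ⟨a, h⟩ else η (a - w)

@[simp] theorem memory_reg (ρ : Fin w → ℕ) (η : ℕ → ℕ) (r : Fin w) : memory ρ η r = ρ r := by
  simp [memory]

@[simp] theorem memory_heap (ρ : Fin w → ℕ) (η : ℕ → ℕ) (a : ℕ) : memory ρ η (a + w) = η a := by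
  simp [memory]

theorem update_memory_reg (ρ : Fin w → ℕ) (η : ℕ → ℕ) (r : Fin w) (v : ℕ) :
    Function.update (memory ρ η) r v = memory (Function.update ρ r v) η := by
  ext a
  by_cases h : a < w
  · rcases eq_or_ne (⟨a, h⟩ : Fin w) r with rfl | hr
    · simp [memory, h]
    · have : a ≠ r := fun he => hr (Fin.ext he)
      simp [memory, h, this, hr]
  · have : a ≠ r := by have := r.2; omega
    simp [memory, h, this]

theorem update_memory_heap (ρ : Fin w → ℕ) (η : ℕ → ℕ) (i : ℕ) (v : ℕ) :
    Function.update (memory ρ η) (i + w) v = memory ρ (Function.update η i v) := by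
  ext a
  by_cases h : a < w
  · have : a ≠ i + w := by omega
    simp [memory, h, this]
  · rcases eq_or_ne a (i + w) with rfl | ha
    · simp [memory]
    · have : a - w ≠ i := by omega
      simp [memory, h, this, ha]

section Blocks

variable {M : NRAM} {n : ℕ} {f : Fin n → Fin n} {s m : ℕ} {A B : ℕ} {ρ : Fin w → ℕ} {η : ℕ → ℕ}

theorem block_loadReg (hs : w ≤ s) (r : Fin w) :
    M.Block f s m (loadReg r) (A, B, memory ρ η) (ρ r, B, memory ρ η) := by
  have := r.2
  have h := (NRAM.Block.zero.append (NRAM.Block.incs r)).append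
    (NRAM.Block.load (M := M) (f := f) (s := s) (m := m) (A := 0 + r) (B := B) (μ := memory ρ η)
      (by omega)) (x := (A, B, memory ρ η))
  simpa [loadReg] using h

theorem block_storeReg (hs : w ≤ s) (r : Fin w) (hA : A ≤ m) :
    M.Block f s m (storeReg r) (A, B, memory ρ η)
      (r, A, memory (Function.update ρ r A) η) := by
  have := r.2
  have h := ((NRAM.Block.copy.append NRAM.Block.zero).append (NRAM.Block.incs r)).append
    (NRAM.Block.store (M := M) (f := f) (s := s) (m := m) (A := 0 + r) (B := A) (μ := memory ρ η)
      (by omega) hA) (x := (A, B, memory ρ η))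
  simpa [storeReg, update_memory_reg] using h

end Blocks

/-! ### Symbolic execution of register programs -/

/-- A register program with bounds for the sizes of its instructions, for addresses and for
contents. -/
structure Setup (w : ℕ) where
  body : List (RegInstr w)
  accept_notMem : accept ∉ body
  width : ℕ
  size_le : ∀ x ∈ body ++ [accept], x.size ≤ width
  n : ℕ
  f : Fin n → Fin n
  s : ℕ
  m : ℕ
  le_s : w ≤ s
  le_m : n ≤ m

/-- From instruction `i` of the program, with the registers `ρ` and the heap `η`, all computations
perform at most `T` instructions, and one accepts if and only if `P` holds. -/
def Runs (S : Setup w) (i : ℕ) (ρ : Fin w → ℕ) (η : ℕ → ℕ) (T : ℕ) (P : Prop) : Prop :=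
  ∀ A B, (toNRAM S.body S.accept_notMem).Runs S.f S.s S.m
    ⟨offset (S.body ++ [accept]) i, A, B, memory ρ η⟩ (S.width * T) P

namespace Runs

variable {S : Setup w} {i : ℕ} {ρ : Fin w → ℕ} {η : ℕ → ℕ} {T : ℕ} {P Q : Prop} {r q : Fin w}

theorem mono {T' : ℕ} (h : Runs S i ρ η T P) (hT : T ≤ T') : Runs S i ρ η T' P :=
  fun A B => (h A B).mono (Nat.mul_le_mul_left _ hT)

theorem congr (h : Runs S i ρ η T P) (hPQ : P ↔ Q) : Runs S i ρ η T Q :=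
  propext hPQ ▸ h

/-- The accumulators are scratch space: `Runs` quantifies over them, so a block may leave any values
there. The bounds on `ρ` and `η` are handed to the block because values it copies must again respect
`S.m`. -/
theorem of_block {x : RegInstr w} {ρ' : Fin w → ℕ} {η' : ℕ → ℕ}
    (hx : (S.body ++ [accept])[i]? = some x)
    (hb : (∀ r, ρ r ≤ S.m) → (∀ a, η a ≤ S.m) → ∀ A B, ∃ A' B',
      (toNRAM S.body S.accept_notMem).Block S.f S.s S.m
        (x.compile (offset (S.body ++ [accept]))) (A, B, memory ρ η) (A', B', memory ρ' η'))
    (h : Runs S (i + 1) ρ' η' T P) : Runs S i ρ η (T + 1) P := by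
  intro A B hm
  have hρ : ∀ r, ρ r ≤ S.m := fun r => by simpa using hm r
  have hη : ∀ a, η a ≤ S.m := fun a => by simpa using hm (a + w)
  obtain ⟨A', B', hblock⟩ := hb hρ hη A B
  have hr := hblock _ _ P (codeAt hx) (by
    have := h A' B'
    rw [offset_succ hx] at this
    rwa [length_compile])
  -- One unit of `T` stands for `S.width` RAM steps, enough for any single register instruction.
  refine hr.mono ?_ hm
  rw [length_compile, Nat.mul_succ]
  exact Nat.add_le_add_left (S.size_le x (List.mem_of_getElem? hx)) _

theorem zero (hx : (S.body ++ [accept])[i]? = some (zero r))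
    (h : Runs S (i + 1) (Function.update ρ r 0) η T P) : Runs S i ρ η (T + 1) P :=
  of_block hx (fun _ _ _ _ => ⟨_, _, NRAM.Block.zero.append
    (block_storeReg S.le_s r (Nat.zero_le _))⟩) h

theorem add {k : ℕ} (hx : (S.body ++ [accept])[i]? = some (add r k)) (hk : ρ r + k ≤ S.m)
    (h : Runs S (i + 1) (Function.update ρ r (ρ r + k)) η T P) : Runs S i ρ η (T + 1) P :=
  of_block hx (fun _ _ _ _ => ⟨_, _, ((block_loadReg S.le_s r).append (NRAM.Block.incs k)).append
    (block_storeReg S.le_s r hk)⟩) h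

theorem dec (hx : (S.body ++ [accept])[i]? = some (dec r))
    (h : Runs S (i + 1) (Function.update ρ r (ρ r - 1)) η T P) : Runs S i ρ η (T + 1) P :=
  of_block hx (fun hρ _ _ _ => ⟨_, _, ((block_loadReg S.le_s r).append NRAM.Block.dec).append
    (block_storeReg S.le_s r ((Nat.sub_le _ _).trans (hρ r)))⟩) h

theorem move (hx : (S.body ++ [accept])[i]? = some (move r q))
    (h : Runs S (i + 1) (Function.update ρ r (ρ q)) η T P) : Runs S i ρ η (T + 1) P :=
  of_block hx (fun hρ _ _ _ => ⟨_, _, (block_loadReg S.le_s q).append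
    (block_storeReg S.le_s r (hρ q))⟩) h

theorem len (hx : (S.body ++ [accept])[i]? = some (len r))
    (h : Runs S (i + 1) (Function.update ρ r S.n) η T P) : Runs S i ρ η (T + 1) P :=
  of_block hx (fun _ _ _ _ => ⟨_, _, NRAM.Block.loadLen.append
    (block_storeReg S.le_s r S.le_m)⟩) h

theorem query (hx : (S.body ++ [accept])[i]? = some (query r q)) (hq : ρ q < S.n)
    (h : Runs S (i + 1) (Function.update ρ r (S.f ⟨ρ q, hq⟩)) η T P) :
    Runs S i ρ η (T + 1) P :=
  of_block hx (fun _ _ _ _ => ⟨_, _, (((block_loadReg S.le_s q).append NRAM.Block.copy).append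
    (NRAM.Block.query hq)).append
    (block_storeReg S.le_s r ((S.f ⟨ρ q, hq⟩).2.le.trans S.le_m))⟩) h

theorem get (hx : (S.body ++ [accept])[i]? = some (get r q)) (hq : ρ q + w ≤ S.s)
    (h : Runs S (i + 1) (Function.update ρ r (η (ρ q))) η T P) : Runs S i ρ η (T + 1) P :=
  of_block hx (fun _ hη _ _ => ⟨_, _, (((block_loadReg S.le_s q).append
    (NRAM.Block.incs w)).append (NRAM.Block.load hq)).append
    (by rw [memory_heap]; exact block_storeReg S.le_s r (hη _))⟩) h

theorem put (hx : (S.body ++ [accept])[i]? = some (put r q)) (hr : ρ r + w ≤ S.s)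
    (h : Runs S (i + 1) ρ (Function.update η (ρ r) (ρ q)) T P) : Runs S i ρ η (T + 1) P :=
  of_block hx (fun hρ _ _ _ => ⟨_, _, ((((block_loadReg S.le_s q).append
    NRAM.Block.copy).append (block_loadReg S.le_s r)).append (NRAM.Block.incs w)).append
    (by rw [← update_memory_heap]; exact NRAM.Block.store hr (hρ q))⟩) h

theorem jump {i₀ i₁ : ℕ} (hx : (S.body ++ [accept])[i]? = some (jump r q i₀ i₁))
    (h : Runs S (if ρ r = ρ q then i₀ else i₁) ρ η T P) : Runs S i ρ η (T + 1) P := by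
  intro A B
  have hc := codeAt (h := S.accept_notMem) hx
  have hb := ((block_loadReg (M := toNRAM S.body S.accept_notMem) (f := S.f) (m := S.m)
    (A := A) (B := B) (ρ := ρ) (η := η) S.le_s r).append NRAM.Block.copy).append
    (block_loadReg S.le_s q)
  have := hb _ _ P (NRAM.CodeAt.left hc) (NRAM.Runs.branch (NRAM.CodeAt.right hc) (by
    have := h (ρ q) (ρ r)
    rw [apply_ite (offset (S.body ++ [accept]))] at this
    simpa only [eq_comm] using this))
  refine this.mono ?_
  have := S.size_le _ (List.mem_of_getElem? hx)
  rw [← length_compile (offset (S.body ++ [accept])), compile, List.length_append,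
    List.length_singleton] at this
  rw [Nat.mul_succ]
  omega

theorem choose {i₀ i₁ : ℕ} (hx : (S.body ++ [accept])[i]? = some (choose i₀ i₁))
    (h₀ : Runs S i₀ ρ η T P) (h₁ : Runs S i₁ ρ η T Q) : Runs S i ρ η (T + 1) (P ∨ Q) := by
  intro A B
  have hc := codeAt (h := S.accept_notMem) hx
  have hb := (NRAM.Block.zero (M := toNRAM S.body S.accept_notMem) (f := S.f) (s := S.s) (m := S.m)
    (A := A) (B := B) (μ := memory ρ η)).append NRAM.Block.copy
  -- The guess is compared with `B = 0`: guessing `0` selects `i₀`, every other number selects `i₁`.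
  have := hb _ _ (∃ x : ℕ, if x = 0 then P else Q) hc.left.left
    (NRAM.Runs.guess hc.left.right (fun x => NRAM.Runs.branch hc.right (T := S.width * T) (by
      dsimp only
      split_ifs with hx
      · exact h₀ _ _
      · exact h₁ _ _)))
  have hPQ : (∃ x : ℕ, if x = 0 then P else Q) ↔ P ∨ Q := by
    constructor
    · rintro ⟨x, hx⟩
      split_ifs at hx
      exacts [Or.inl hx, Or.inr hx]
    · rintro (h | h)
      exacts [⟨0, by simpa using h⟩, ⟨1, by simpa using h⟩]
  rw [← propext hPQ]
  refine this.mono ?_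
  have := S.size_le _ (List.mem_of_getElem? hx)
  simp only [size, compile, List.length_append, List.length_singleton] at this
  simp only [List.length_append, List.length_singleton, Nat.mul_succ]
  omega

theorem reject (hx : (S.body ++ [accept])[i]? = some .reject) : Runs S i ρ η T False :=
  fun _ _ => (NRAM.Runs.reject (codeAt hx)).mono (Nat.zero_le _)

theorem accept (hx : (S.body ++ [RegInstr.accept])[i]? = some .accept) : Runs S i ρ η T True :=
  fun _ _ => (NRAM.Runs.accept (codeAt hx)).mono (Nat.zero_le _)

theorem bounds (h : Runs S 0 (fun _ => 0) (fun _ => 0) T P) :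
    (toNRAM S.body S.accept_notMem).RunsInTime S.f (S.width * T) ∧
    (toNRAM S.body S.accept_notMem).RunsInSpace S.f S.s S.m ∧
    ((toNRAM S.body S.accept_notMem).Accepts S.f ↔ P) := by
  apply NRAM.Runs.bounds
  have := h 0 0
  have hm : memory (w := w) (fun _ => 0) (fun _ => 0) = fun _ => 0 := by
    ext a; simp [memory]
  rw [hm] at this
  exact this

end Runs

end RegInstr

/-! ## Guessing labels along a separating tree -/

namespace SepTree

variable {V : Type}

/-- The vertices of a list, preceded on the branch by `p` with labels `ls`, can be given labels
such that adjacent vertices of the branch have different labels and `Q` holds for the labels of the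
branch and the remaining budget. The labels `x < q` are free, the label `i + q` of the `i`-th vertex
of the branch costs one unit of the budget `b`. -/
def ExtendList (G : SimpleGraph V) (q : ℕ) :
    List V → List ℕ → List V → ℕ → (List ℕ → ℕ → Prop) → Prop
  | _, ls, [], b, Q => Q ls b
  | p, ls, v :: vs, b, Q => ∃ x b', (x < q ∧ b' = b ∨ x = ls.length + q ∧ b = b' + 1) ∧
      (∀ i ∈ nbrPositions G p v, ls.getD i 0 ≠ x) ∧ ExtendList G q (p ++ [v]) (ls ++ [x]) vs b' Q

/-- The same for the vertices of a subtree below the branch `p`. -/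
def ExtendTree (G : SimpleGraph V) (q : ℕ) :
    List V → List ℕ → SepTree V → ℕ → (ℕ → Prop) → Prop
  | p, ls, leaf E, b, Q => ExtendList G q p ls E b (fun _ b' => Q b')
  | p, ls, node E l r, b, Q => ExtendList G q p ls E b (fun ls' b' =>
      ExtendTree G q (p ++ E) ls' l b' (fun b'' => ExtendTree G q (p ++ E) ls' r b'' Q))

/-- The maximal number of vertices and inner nodes on a branch. -/
def height : SepTree V → ℕ
  | leaf E => E.length
  | node E l r => E.length + 1 + max l.height r.height

theorem lt_of_mem_nbrPositions {G : SimpleGraph V} {p : List V} {v : V} {i : ℕ}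
    (h : i ∈ nbrPositions G p v) : i < p.length := by
  simp only [nbrPositions, List.mem_filter, List.mem_range] at h
  exact h.1

end SepTree

/-! ## The program -/

namespace SepTree

open RegInstr

/-- The program: it guesses labels for the vertices in the order in which they are listed.
Registers: `0` input position, `1` length of the branch, `2` budget, `3` top of the stack of
branch lengths to which the machine returns, `4` bottom of this stack, `5` vertices to be read,
`6` neighbours to be read, `7` label, `8` auxiliary, `9` zero, `10` mark of the node, `11` number of
free labels. The labels of the branch begin at the heap address `0`. Instructions `2`-`8` put
a multiple of about `√(2n)` into register `3`. -/
def program (a b : RegInstr 12) (q K : ℕ) : List (RegInstr 12) :=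
  [len 5, add 11 q,
    add 6 1, add 3 K, move 8 6,
    jump 7 5 9 6,
    add 7 1, dec 8, jump 8 9 2 5,
    move 4 3, a, b,
    query 10 0, add 0 1, query 5 0, add 0 1,
    jump 5 9 37 17,
    dec 5, query 6 0, add 0 1, zero 7,
    choose 28 22,
    add 7 1, jump 7 11 24 21,
    jump 2 9 41 25,
    dec 2, move 7 1, add 7 q,
    jump 6 9 34 29,
    dec 6, query 8 0, add 0 1, get 8 8, jump 8 7 41 28,
    put 1 7, add 1 1, jump 9 9 16 16,
    jump 10 9 42 38,
    put 3 1, add 3 1, jump 9 9 12 12,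
    reject,
    jump 3 4 46 43,
    dec 3, get 1 3, jump 9 9 12 12]

/-- The contents of the registers while the machine walks through the tree. -/
structure Regs (q ptr L b D base cnt mark : ℕ) (ρ : Fin 12 → ℕ) : Prop where
  h0 : ρ 0 = ptr
  h1 : ρ 1 = L
  h2 : ρ 2 = b
  h3 : ρ 3 = D
  h4 : ρ 4 = base
  h5 : ρ 5 = cnt
  h9 : ρ 9 = 0
  h10 : ρ 10 = mark
  h11 : ρ 11 = q

/-- The heap contains the list `l` from address `o` on. -/
def Holds (η : ℕ → ℕ) (o : ℕ) (l : List ℕ) : Prop := ∀ i x, l[i]? = some x → η (o + i) = x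

theorem Holds.prefix {η : ℕ → ℕ} {o : ℕ} {l l' : List ℕ} (h : Holds η o l') (hl : l <+: l') :
    Holds η o l := by
  obtain ⟨t, rfl⟩ := hl
  exact fun i x hx => h i x (by
    rw [List.getElem?_append_left (List.getElem?_eq_some_iff.1 hx).1, hx])

theorem Holds.snoc {η : ℕ → ℕ} {o x : ℕ} {l : List ℕ} (h : Holds η o l) :
    Holds (Function.update η (o + l.length) x) o (l ++ [x]) := by
  intro i y hy
  rcases lt_trichotomy i l.length with hi | rfl | hi
  · rw [List.getElem?_append_left hi] at hy
    rw [Function.update_of_ne (by omega), h i y hy]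
  · simpa using hy
  · have := (List.getElem?_eq_some_iff.1 hy).1
    simp at this; omega

theorem Holds.update {η : ℕ → ℕ} {o a x : ℕ} {l : List ℕ} (h : Holds η o l)
    (ha : a < o ∨ o + l.length ≤ a) : Holds (Function.update η a x) o l := by
  intro i y hy
  have := (List.getElem?_eq_some_iff.1 hy).1
  rw [Function.update_of_ne (by omega), h i y hy]

theorem Holds.getD {η : ℕ → ℕ} {l : List ℕ} (h : Holds η 0 l) {i : ℕ} (hi : i < l.length) :
    η i = l.getD i 0 := by
  simpa [hi] using h i _ (List.getElem?_eq_getElem hi)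

/-! ### Correctness of the loops of the program. -/

section Execution

variable {S : Setup 12} {a b : RegInstr 12} {q K : ℕ}

/-- The input as a list. -/
def input (S : Setup 12) : List ℕ := List.ofFn (fun i => (S.f i : ℕ))

theorem input_cons {ptr x : ℕ} {l : List ℕ} (h : (input S).drop ptr = x :: l) :
    ∃ hp : ptr < S.n, (S.f ⟨ptr, hp⟩ : ℕ) = x ∧ (input S).drop (ptr + 1) = l := by
  have hp : ptr < (input S).length := by
    by_contra hp
    rw [List.drop_eq_nil_of_le (by omega)] at h
    cases h
  rw [List.drop_eq_getElem_cons hp] at h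
  obtain ⟨h1, h2⟩ := List.cons.inj h
  refine ⟨by simpa [input] using hp, ?_, h2⟩
  rw [← h1]
  simp [input]

theorem instr_at (hS : S.body = program a b q K) {i : ℕ} {x : RegInstr 12}
    (h : (program a b q K ++ [accept])[i]? = some x) : (S.body ++ [accept])[i]? = some x :=
  hS ▸ h

/-- A listed neighbour is a position on the branch and hence the heap address of its label. A
conflict leads to `reject`, so the tests become conjuncts of the outcome. A neighbour takes six
instructions, the final exit test one. -/
theorem runs_check (hS : S.body = program a b q K) (hm : S.s + q + S.n + 1 ≤ S.m)
    {ls : List ℕ} {η : ℕ → ℕ} (hη : Holds η 0 ls) (hls : ls.length + 12 ≤ S.s)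
    {x L bu D base cnt mark T : ℕ} {P : Prop} {rest : List ℕ} (is : List ℕ)
    (his : ∀ i ∈ is, i < ls.length) {ptr : ℕ} {ρ : Fin 12 → ℕ}
    (hρ : Regs q ptr L bu D base cnt mark ρ) (h6 : ρ 6 = is.length) (h7 : ρ 7 = x)
    (hin : (input S).drop ptr = is ++ rest)
    (hk : ∀ ρ', Regs q (ptr + is.length) L bu D base cnt mark ρ' → ρ' 7 = x →
      (input S).drop (ptr + is.length) = rest → Runs S 34 ρ' η T P) :
    Runs S 28 ρ η (T + 6 * is.length + 1) ((∀ i ∈ is, ls.getD i 0 ≠ x) ∧ P) := by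
  induction is generalizing ptr ρ with
  | nil =>
    refine .jump (instr_at hS rfl) ?_
    obtain ⟨h0, h1, h2, h3, h4, h5, h9, h10, h11⟩ := id hρ
    rw [if_pos (by simp [h6, h9])]
    simpa using hk ρ hρ h7 hin
  | cons i is ih =>
    obtain ⟨h0, h1, h2, h3, h4, h5, h9, h10, h11⟩ := id hρ
    obtain ⟨hp, hf, hin'⟩ := input_cons hin
    have hi : i < ls.length := his i (by simp)
    refine .mono (T := (T + 6 * is.length + 1) + 1 + 1 + 1 + 1 + 1 + 1) ?_
      (by simp only [List.length_cons]; omega)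
    refine .jump (instr_at hS rfl) ?_
    rw [if_neg (by simp [h6, h9])]
    refine .dec (instr_at hS rfl) (.query (instr_at hS rfl) (by simpa [h0] using hp)
      (.add (instr_at hS rfl) (by simp [h0]; omega) (.get (instr_at hS rfl)
        (by simp [h0, hf]; omega) (.jump (instr_at hS rfl) ?_))))
    simp only [Function.update_self, h0, hf, h7, ne_eq, Fin.reduceEq, not_false_eq_true,
      Function.update_of_ne, hη.getD hi]
    by_cases hx : ls.getD i 0 = x
    · rw [if_pos hx]
      exact (Runs.reject (instr_at hS rfl)).congr (iff_of_false id fun h => h.1 i (by simp) hx)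
    · rw [if_neg hx]
      refine (ih (fun j hj => his j (by simp [hj])) (ptr := ptr + 1) ?_ ?_ ?_ hin' ?_).congr ?_
      · constructor <;> simp [*]
      · simp [h6]
      · simp [h7]
      · intro ρ' hρ' h7' hin''
        have hl : ptr + 1 + is.length = ptr + (i :: is).length := by simp; omega
        rw [hl] at hρ' hin''
        exact hk ρ' hρ' h7' hin''
      · rw [List.forall_mem_cons, and_assoc]
        exact ⟨fun h => ⟨hx, h⟩, fun h => h.2⟩

/-- Only binary choices are available, so the label is found by counting: keep `x` or pass on to `x
+ 1`. Here `d + 1` free labels, from `x` to `q - 1`, are still on offer; declining the last one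
means paying. -/
theorem runs_choose (hS : S.body = program a b q K) (hm : S.s + q + S.n + 1 ≤ S.m) {η : ℕ → ℕ}
    {ptr L bu D base cnt mark deg T : ℕ} (hL : L ≤ S.s) {P : ℕ → ℕ → Prop}
    (hfree : ∀ y < q, ∀ ρ', Regs q ptr L bu D base cnt mark ρ' → ρ' 6 = deg → ρ' 7 = y →
      Runs S 28 ρ' η T (P y bu))
    (hpaid : ∀ b', bu = b' + 1 → ∀ ρ', Regs q ptr L b' D base cnt mark ρ' → ρ' 6 = deg →
      ρ' 7 = L + q → Runs S 28 ρ' η T (P (L + q) b'))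
    (d : ℕ) {x : ℕ} (hx : x + (d + 1) = q) {ρ : Fin 12 → ℕ}
    (hρ : Regs q ptr L bu D base cnt mark ρ) (h6 : ρ 6 = deg) (h7 : ρ 7 = x) :
    Runs S 21 ρ η (T + 3 * (d + 1) + 4)
      (∃ y b', ((x ≤ y ∧ y < q) ∧ b' = bu ∨ y = L + q ∧ bu = b' + 1) ∧ P y b') := by
  induction d generalizing x ρ with
  | zero =>
    obtain ⟨h0, h1, h2, h3, h4, h5, h9, h10, h11⟩ := id hρ
    have hpay : Runs S 22 ρ η (T + 6) (∃ b', bu = b' + 1 ∧ P (L + q) b') := by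
      refine .add (instr_at hS rfl) (by omega) (.jump (instr_at hS rfl) ?_)
      rw [if_pos (by simp [h7, h11]; omega)]
      refine .jump (instr_at hS rfl) ?_
      cases bu with
      | zero =>
        rw [if_pos (by simp [h2, h9])]
        exact (Runs.reject (instr_at hS rfl)).congr (by simp)
      | succ b' =>
        rw [if_neg (by simp [h2, h9])]
        refine .dec (instr_at hS rfl) (.move (instr_at hS rfl) (.add (instr_at hS rfl)
          (by simp [h1]; omega) ((hpaid b' rfl _ ?_ ?_ ?_).congr ?_)))
        · constructor <;> simp [*]
        · simp [h6]
        · simp [h1]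
        · simp
    refine .mono (.congr (.choose (instr_at hS rfl) ((hfree x (by omega) ρ hρ h6 h7).mono
      (Nat.le_add_right T 6)) hpay) ?_) (by omega)
    constructor
    · rintro (h | ⟨b', h, h'⟩)
      exacts [⟨x, bu, Or.inl ⟨⟨le_rfl, by omega⟩, rfl⟩, h⟩, ⟨_, b', Or.inr ⟨rfl, h⟩, h'⟩]
    · rintro ⟨y, b', ⟨hy, rfl⟩ | ⟨rfl, h⟩, h'⟩
      · obtain rfl : y = x := by omega
        exact Or.inl h'
      · exact Or.inr ⟨b', h, h'⟩
  | succ d ih =>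
    obtain ⟨h0, h1, h2, h3, h4, h5, h9, h10, h11⟩ := id hρ
    have hnext : Runs S 22 ρ η (T + 3 * (d + 1) + 6)
        (∃ y b', ((x + 1 ≤ y ∧ y < q) ∧ b' = bu ∨ y = L + q ∧ bu = b' + 1) ∧ P y b') := by
      refine .add (instr_at hS rfl) (by omega) (.jump (instr_at hS rfl) ?_)
      rw [if_neg (by simp [h7, h11]; omega)]
      refine ih (x := x + 1) (by omega) ?_ (by simp [h6]) (by simp [h7])
      constructor <;> simp [*]
    refine .mono (.congr (.choose (instr_at hS rfl) ((hfree x (by omega) ρ hρ h6 h7).mono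
      (by omega)) hnext) ?_) (Nat.le_of_eq (by ring))
    constructor
    · rintro (h | ⟨y, b', h | h, h'⟩)
      · exact ⟨x, bu, Or.inl ⟨⟨le_rfl, by omega⟩, rfl⟩, h⟩
      · exact ⟨y, b', Or.inl ⟨⟨by omega, h.1.2⟩, h.2⟩, h'⟩
      · exact ⟨y, b', Or.inr h, h'⟩
    · rintro ⟨y, b', ⟨hy, rfl⟩ | h, h'⟩
      · rcases hy.1.eq_or_lt with rfl | hlt
        · exact Or.inl h'
        · exact Or.inr ⟨y, _, Or.inl ⟨⟨hlt, hy.2⟩, rfl⟩, h'⟩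
      · exact Or.inr ⟨y, b', Or.inr h, h'⟩

variable {V : Type} {G : SimpleGraph V}

/-- A vertex with `j` listed neighbours occupies `j + 1` entries; the selection of its label is
charged to the entry holding `j`, the comparisons to the others, which gives `3 * q + 20` per entry.
The prefix condition in `hk` lets the caller keep the labels of the ancestors. -/
theorem runs_verts (hS : S.body = program a b q K) (hm : S.s + q + S.n + 1 ≤ S.m) (hq : 0 < q)
    {D base mark T : ℕ} (hbase : base + 12 ≤ S.s) {ps rest : List ℕ} {Q : List ℕ → ℕ → Prop}
    (vs : List V) {p : List V} {ls : List ℕ} {η : ℕ → ℕ} (hη : Holds η 0 ls)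
    (hps : Holds η base ps) (hp : ls.length = p.length) (hls : ls.length + vs.length ≤ base)
    {ptr bu : ℕ} {ρ : Fin 12 → ℕ} (hρ : Regs q ptr ls.length bu D base vs.length mark ρ)
    (hin : (input S).drop ptr = encodeVerts G p vs ++ rest)
    (hk : ∀ ls' b' ρ' η', ls <+: ls' → ls'.length = ls.length + vs.length → Holds η' 0 ls' →
      Holds η' base ps →
      Regs q (ptr + (encodeVerts G p vs).length) ls'.length b' D base 0 mark ρ' →
      (input S).drop (ptr + (encodeVerts G p vs).length) = rest → Runs S 37 ρ' η' T (Q ls' b')) :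
    Runs S 16 ρ η (T + (3 * q + 20) * (encodeVerts G p vs).length + 1)
      (ExtendList G q p ls vs bu Q) := by
  induction vs generalizing p ls η ptr bu ρ with
  | nil =>
    refine .jump (instr_at hS rfl) ?_
    rw [if_pos (by simp [hρ.h5, hρ.h9])]
    exact hk ls bu ρ η (List.prefix_refl _) rfl hη hps hρ hin
  | cons v vs ih =>
    obtain ⟨h0, h1, h2, h3, h4, h5, h9, h10, h11⟩ := id hρ
    obtain ⟨hp0, hf, hin1⟩ := input_cons hin
    simp only [List.length_cons] at hls
    have hrec : ∀ x b' ρ', x ≤ ls.length + q →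
        Regs q (ptr + 1) ls.length b' D base vs.length mark ρ' →
        ρ' 6 = (nbrPositions G p v).length → ρ' 7 = x →
        Runs S 28 ρ' η (T + (3 * q + 20) * (encodeVerts G (p ++ [v]) vs).length + 1 + 3 +
            6 * (nbrPositions G p v).length + 1)
          ((∀ i ∈ nbrPositions G p v, ls.getD i 0 ≠ x) ∧
            ExtendList G q (p ++ [v]) (ls ++ [x]) vs b' Q) := by
      intro x b' ρ' hx hρ' h6' h7'
      refine runs_check hS hm hη (by omega) (nbrPositions G p v)
        (fun i hi => hp ▸ lt_of_mem_nbrPositions hi) hρ' h6' h7'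
        (rest := encodeVerts G (p ++ [v]) vs ++ rest) (by rw [hin1, ← List.append_assoc]; rfl) ?_
      intro ρ'' hρ'' h7'' hin''
      obtain ⟨h0, h1, h2, h3, h4, h5, h9, h10, h11⟩ := id hρ''
      refine .put (instr_at hS rfl) (by omega) (.add (instr_at hS rfl) (by omega)
        (.jump (instr_at hS rfl) ?_))
      rw [ite_self, h1, h7'']
      -- The new label goes to the address `ls.length`, which is below `base`, so the stack is
      -- untouched.
      refine ih (ptr := ptr + 1 + (nbrPositions G p v).length)
        (by simpa using hη.snoc (x := x)) (hps.update (by omega)) (by simp [hp])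
        (by simp; omega) ?_ hin'' ?_
      · constructor <;> simp [*]
      · intro ls' b'' ρ₁ η' hpre hlen hη' hps' hρ₁ hin₁
        have he : ptr + 1 + (nbrPositions G p v).length +
            (encodeVerts G (p ++ [v]) vs).length =
            ptr + (encodeVerts G p (v :: vs)).length := by
          simp [encodeVerts]; omega
        rw [he] at hρ₁ hin₁
        exact hk ls' b'' ρ₁ η' ((List.prefix_append _ _).trans hpre)
          (by simp at hlen; simp; omega) hη' hps' hρ₁ hin₁
    refine .mono (T := T + (3 * q + 20) * (encodeVerts G (p ++ [v]) vs).length + 1 + 3 +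
      6 * (nbrPositions G p v).length + 1 + 3 * (q - 1 + 1) + 4 + 1 + 1 + 1 + 1 + 1) ?_ ?_
    · refine .jump (instr_at hS rfl) ?_
      rw [if_neg (by simp [h5, h9])]
      refine .dec (instr_at hS rfl) (.query (instr_at hS rfl) (by simpa [h0] using hp0)
        (.add (instr_at hS rfl) (by simp [h0]; omega) (.zero (instr_at hS rfl) ?_)))
      refine (runs_choose hS hm (L := ls.length) (by omega) (bu := bu)
        (P := fun x b' => (∀ i ∈ nbrPositions G p v, ls.getD i 0 ≠ x) ∧
          ExtendList G q (p ++ [v]) (ls ++ [x]) vs b' Q)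
        (fun y hy ρ' hρ' h6' h7' => hrec y bu ρ' (by omega) hρ' h6' h7')
        (fun b' hb' ρ' hρ' h6' h7' => hrec _ b' ρ' le_rfl hρ' h6' h7')
        (q - 1) (x := 0) (by omega) ?_ ?_ ?_).congr ?_
      · constructor <;> simp [*]
      · simp [h0, hf]
      · simp
      · simp [ExtendList]
    · simp only [encodeVerts, List.length_cons, List.length_append]
      have : q - 1 + 1 = q := by omega
      rw [this]
      nlinarith [Nat.zero_le (q * (nbrPositions G p v).length)]

/-- The machine never stores the shape of the tree. When a subtree ends, the top of the stack is the
branch length at the last inner node whose right subtree is still to come, and that subtree is next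
in the input. Hence `hk` allows any `L'`; only the labels `ls` and the stack `ps` must survive.
Since `height` counts vertices and inner nodes, it bounds the growth of both areas. -/
theorem runs_tree (hS : S.body = program a b q K) (hm : S.s + q + S.n + 1 ≤ S.m) (hq : 0 < q)
    {base : ℕ} (t : SepTree V) {p : List V} {ls ps rest : List ℕ} {η : ℕ → ℕ} (hη : Holds η 0 ls)
    (hps : Holds η base ps) (hp : ls.length = p.length) (hls : ls.length + t.height ≤ base)
    (hpl : base + ps.length + t.height + 12 ≤ S.s) {T : ℕ} {Q : ℕ → Prop}
    {ptr bu cnt mark : ℕ} {ρ : Fin 12 → ℕ}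
    (hρ : Regs q ptr ls.length bu (base + ps.length) base cnt mark ρ)
    (hin : (input S).drop ptr = encode G p t ++ rest)
    (hk : ∀ L' b' cnt' mark' ρ' η', Holds η' 0 ls → Holds η' base ps →
      Regs q (ptr + (encode G p t).length) L' b' (base + ps.length) base cnt' mark' ρ' →
      (input S).drop (ptr + (encode G p t).length) = rest → Runs S 42 ρ' η' T (Q b')) :
    Runs S 12 ρ η (T + (3 * q + 20) * (encode G p t).length) (ExtendTree G q p ls t bu Q) := by
  induction t generalizing p ls ps rest η T Q ptr bu cnt mark ρ with
  | leaf E =>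
    obtain ⟨h0, h1, h2, h3, h4, h5, h9, h10, h11⟩ := id hρ
    obtain ⟨hp0, hf0, hin0⟩ := input_cons hin
    obtain ⟨hp1, hf1, hin1⟩ := input_cons hin0
    simp only [height] at hls hpl
    refine .mono (T := T + 1 + (3 * q + 20) * (encodeVerts G p E).length + 1 + 1 + 1 + 1 + 1) ?_ ?_
    · refine .query (instr_at hS rfl) (by omega) (.add (instr_at hS rfl) (by simp [h0]; omega)
        (.query (instr_at hS rfl) (by simp [h0]; omega)
        (.add (instr_at hS rfl) (by simp [h0]; omega) ?_)))
      refine runs_verts hS hm hq (D := base + ps.length) (mark := 0) (by omega) E hη hps hp hls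
        (ptr := ptr + 1 + 1) ?_ hin1 ?_
      · constructor <;> simp [*]
      · intro ls' b' ρ' η' hpre hlen hη' hps' hρ' hin'
        refine .jump (instr_at hS rfl) ?_
        rw [if_pos (by simp [hρ'.h10, hρ'.h9])]
        have he : ptr + 1 + 1 + (encodeVerts G p E).length =
            ptr + (encode G p (leaf E)).length := by simp [encode]; omega
        rw [he] at hρ' hin'
        exact hk _ b' _ _ ρ' η' (hη'.prefix hpre) hps' hρ' hin'
    · simp only [encode, List.length_cons]
      nlinarith
  | node E l r ihl ihr =>
    obtain ⟨h0, h1, h2, h3, h4, h5, h9, h10, h11⟩ := id hρ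
    simp only [encode, List.cons_append, List.append_assoc] at hin
    obtain ⟨hp0, hf0, hin0⟩ := input_cons hin
    obtain ⟨hp1, hf1, hin1⟩ := input_cons hin0
    simp only [height] at hls hpl
    have hle := le_max_left l.height r.height
    have hre := le_max_right l.height r.height
    refine .mono (T := T + (3 * q + 20) * (encode G (p ++ E) r).length + 4 +
      (3 * q + 20) * (encode G (p ++ E) l).length + 1 + 1 + 1 + 1 +
      (3 * q + 20) * (encodeVerts G p E).length + 1 + 1 + 1 + 1 + 1) ?_ ?_
    · refine .query (instr_at hS rfl) (by omega) (.add (instr_at hS rfl) (by simp [h0]; omega)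
        (.query (instr_at hS rfl) (by simp [h0]; omega)
        (.add (instr_at hS rfl) (by simp [h0]; omega) ?_)))
      refine runs_verts hS hm hq (D := base + ps.length) (mark := 1) (by omega) E hη hps hp
        (by omega) (ptr := ptr + 1 + 1) ?_ hin1 ?_
      · constructor <;> simp [*]
      · intro ls' b' ρ' η' hpre hlen hη' hps' hρ' hin'
        obtain ⟨h0', h1', h2', h3', h4', h5', h9', h10', h11'⟩ := id hρ'
        refine .jump (instr_at hS rfl) ?_
        rw [if_neg (by simp [h10', h9'])]
        refine .put (instr_at hS rfl) (by omega) (.add (instr_at hS rfl) (by omega)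
          (.jump (instr_at hS rfl) ?_))
        rw [ite_self, h3', h1']
        -- While the left subtree is read, the stack carries the branch length to return to.
        refine ihl (ps := ps ++ [ls'.length]) (hη'.update (by omega)) hps'.snoc (by simp; omega)
          (by omega) (by simp; omega) (cnt := 0) (mark := 1) ?_ hin' ?_
        · constructor <;> simp [*, Nat.add_assoc]
        · intro L₁ b₁ cnt₁ mark₁ ρ₁ η₁ hη₁ hps₁ hρ₁ hin₁
          obtain ⟨h0₁, h1₁, h2₁, h3₁, h4₁, h5₁, h9₁, h10₁, h11₁⟩ := id hρ₁
          simp only [List.length_append, List.length_singleton] at h3₁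
          have hval : η₁ (base + ps.length) = ls'.length := hps₁ _ _ (by simp)
          refine .jump (instr_at hS rfl) ?_
          rw [if_neg (by omega)]
          have hD : ρ₁ 3 - 1 = base + ps.length := by omega
          refine .dec (instr_at hS rfl) (.get (instr_at hS rfl) (by simp; omega)
            (.jump (instr_at hS rfl) ?_))
          rw [ite_self]
          -- The entry is popped before the right subtree is read: the stack is `ps` again, and
          -- labels left behind beyond `ls'` may be overwritten.
          refine ihr hη₁ (hps₁.prefix (List.prefix_append _ _)) (by simp; omega)
            (by omega) (by omega) (cnt := cnt₁) (mark := mark₁) ?_ hin₁ ?_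
          · constructor <;> simp [*]
          · intro L₂ b₂ cnt₂ mark₂ ρ₂ η₂ hη₂ hps₂ hρ₂ hin₂
            have he : ptr + 1 + 1 + (encodeVerts G p E).length + (encode G (p ++ E) l).length +
                (encode G (p ++ E) r).length = ptr + (encode G p (node E l r)).length := by
              simp [encode]; omega
            rw [he] at hρ₂ hin₂
            exact hk _ b₂ _ _ ρ₂ η₂ (hη₂.prefix hpre) hps₂ hρ₂ hin₂
    · simp only [encode, List.length_cons, List.length_append]
      nlinarith

end Execution

end SepTree

namespace SepTree

open RegInstr

/-! ### Laying out the memory and starting the walk. -/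

section Start

variable {S : Setup 12} {a b : RegInstr 12} {q K : ℕ}

/-- The numbers up to `n` are counted off in blocks of lengths `1, 2, 3, …`: `x` have been counted,
`r` is the length of the current block and `y` what is left of it. So `x + y` is the `r`-th
triangular number, which at `x = n` makes `r` of order `√n`. Linear time suffices, and `K * r` grows
by `K` with each block. -/
theorem runs_sqrt (hS : S.body = program a b q K) (hm : S.s + q + S.n + 1 ≤ S.m) (hK : 0 < K)
    (hs : 2 * (K * (Nat.sqrt (2 * S.n) + 1)) + 12 ≤ S.s) {η : ℕ → ℕ} {T : ℕ} {P : Prop}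
    (hk : ∀ r ρ, S.n ≤ r * r → r ≤ Nat.sqrt (2 * S.n) + 1 → ρ 3 = K * r → ρ 0 = 0 → ρ 1 = 0 →
      ρ 2 = 0 → ρ 9 = 0 → ρ 11 = q → Runs S 9 ρ η T P)
    (d : ℕ) {r x y : ℕ} (hd : x + d = S.n) (hy : 1 ≤ y) (hyr : y ≤ r)
    (hr : 2 * (x + y) = r * (r + 1)) {ρ : Fin 12 → ℕ} (h0 : ρ 0 = 0) (h1 : ρ 1 = 0)
    (h2 : ρ 2 = 0) (h3 : ρ 3 = K * r) (h5 : ρ 5 = S.n) (h6 : ρ 6 = r) (h7 : ρ 7 = x)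
    (h8 : ρ 8 = y) (h9 : ρ 9 = 0) (h11 : ρ 11 = q) :
    Runs S 5 ρ η (T + 7 * d + 1) P := by
  induction d generalizing r x y ρ with
  | zero =>
    refine .jump (instr_at hS rfl) ?_
    rw [if_pos (by omega)]
    refine hk r ρ (by nlinarith) ?_ h3 h0 h1 h2 h9 h11
    -- For `r = r' + 1`, the bound `y ≤ r` gives `r' * (r' + 1) ≤ 2 * n`.
    obtain ⟨r, rfl⟩ : ∃ r', r = r' + 1 := ⟨r - 1, by omega⟩
    exact Nat.succ_le_succ (Nat.le_sqrt.2 (by nlinarith))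
  | succ d ih =>
    refine .mono (T := T + 7 * d + 1 + 1 + 1 + 1 + 1 + 1 + 1 + 1) ?_ (by omega)
    refine .jump (instr_at hS rfl) ?_
    rw [if_neg (by omega)]
    refine .add (instr_at hS rfl) (by omega) (.dec (instr_at hS rfl) (.jump (instr_at hS rfl) ?_))
    by_cases hy1 : y = 1
    · rw [if_pos (by simp [h8, h9, hy1])]
      have hsq : r ≤ Nat.sqrt (2 * S.n) := Nat.le_sqrt.2 (by nlinarith)
      have hKr : K * (r + 1) ≤ K * (Nat.sqrt (2 * S.n) + 1) := Nat.mul_le_mul_left _ (by omega)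
      have hr1 : r + 1 ≤ K * (r + 1) := Nat.le_mul_of_pos_left _ hK
      rw [Nat.mul_succ] at hKr hr1
      refine .add (instr_at hS rfl) (by simp [h6]; omega) (.add (instr_at hS rfl)
        (by simp [h3]; omega) (.move (instr_at hS rfl) ?_))
      exact ih (r := r + 1) (x := x + 1) (y := r + 1) (by omega) (by omega) le_rfl
        (by subst hy1; linarith) (by simp [h0]) (by simp [h1]) (by simp [h2])
        (by simp [h3, Nat.mul_succ]) (by simp [h5]) (by simp [h6]) (by simp [h7]) (by simp [h6])
        (by simp [h9]) (by simp [h11])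
    · rw [if_neg (by simp [h8, h9]; omega)]
      exact (ih (r := r) (x := x + 1) (y := y - 1) (by omega) (by omega) (by omega)
        (by rw [← hr]; omega) (by simp [h0]) (by simp [h1]) (by simp [h2])
        (by simp [h3]) (by simp [h5]) (by simp [h6]) (by simp [h7]) (by simp [h8])
        (by simp [h9]) (by simp [h11])).mono (by omega)

theorem runs_program {V : Type} {G : SimpleGraph V} (hS : S.body = program a b q K)
    (hm : S.s + q + S.n + 1 ≤ S.m) (hq : 0 < q) (hK : 0 < K)
    (hs : 2 * (K * (Nat.sqrt (2 * S.n) + 1)) + 12 ≤ S.s) (t : SepTree V)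
    (ht : ∀ r, S.n ≤ r * r → t.height ≤ K * r) {ptr k : ℕ}
    (hin : (input S).drop ptr = encode G [] t)
    (hinit : ∀ ρ base T P, Regs q 0 0 0 base base (ρ 5) (ρ 10) ρ →
      (∀ ρ', Regs q ptr 0 k base base (ρ' 5) (ρ' 10) ρ' → Runs S 12 ρ' (fun _ => 0) T P) →
      Runs S 10 ρ (fun _ => 0) (T + 2) P) :
    Runs S 0 (fun _ => 0) (fun _ => 0) ((3 * q + 27) * S.n + 10)
      (ExtendTree G q [] [] t k (fun _ => True)) := by
  have hlen : (encode G [] t).length ≤ S.n := by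
    rw [← hin, List.length_drop, input, List.length_ofFn]
    exact Nat.sub_le _ _
  have hK1 : K * 1 ≤ K * (Nat.sqrt (2 * S.n) + 1) := Nat.mul_le_mul_left _ (by omega)
  refine .mono (T := 1 + (3 * q + 20) * (encode G [] t).length + 2 + 1 + 7 * S.n + 1 +
    1 + 1 + 1 + 1 + 1) ?_ (by nlinarith [Nat.mul_le_mul_left (3 * q + 20) hlen])
  refine .len (instr_at hS rfl) (.add (instr_at hS rfl) (by simp; omega) (.add (instr_at hS rfl)
    (by simp; omega) (.add (instr_at hS rfl) (by simp; omega) (.move (instr_at hS rfl) ?_))))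
  refine runs_sqrt hS hm hK hs ?_ S.n (r := 1) (x := 0) (y := 1) (by omega) le_rfl le_rfl rfl
    (by simp) (by simp) (by simp) (by simp) (by simp) (by simp) (by simp) (by simp) (by simp)
    (by simp)
  intro r ρ hr1 hr2 h3 h0 h1 h2 h9 h11
  have hKr : K * r ≤ K * (Nat.sqrt (2 * S.n) + 1) := Nat.mul_le_mul_left _ hr2
  have htr := ht r hr1
  refine .move (instr_at hS rfl) (hinit _ (K * r) _ _ ?_ ?_)
  · constructor <;> simp [*]
  · intro ρ' hρ'
    -- Labels and return stack get `K * r` cells each, both at least the height of `t`; with the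
    -- twelve registers this explains the `2` and the `12` in `hs`.
    refine runs_tree hS hm hq t (p := []) (ls := []) (ps := []) (rest := []) (ptr := ptr)
      (base := K * r) (fun _ _ h => by simp at h) (fun _ _ h => by simp at h) rfl
      (by simpa using htr) (by simp; omega) hρ' (by simpa using hin) ?_
    intro L' b' cnt' mark' ρ'' η' _ _ hρ'' _
    refine .jump (instr_at hS rfl) ?_
    rw [if_pos (by simp [hρ''.h3, hρ''.h4])]
    exact .accept (instr_at hS rfl)

end Start

/-! ## Labellings -/

section Labels

variable {V : Type} {G : SimpleGraph V} {q : ℕ}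

/-- The labels of the vertices of a branch under a labelling where `none` is paid for. -/
def labels (q : ℕ) (ψ : V → Option ℕ) (p : List V) : List ℕ :=
  p.mapIdx (fun i v => (ψ v).getD (i + q))

theorem labels_snoc (ψ : V → Option ℕ) (p : List V) (v : V) :
    labels q ψ (p ++ [v]) = labels q ψ p ++ [(ψ v).getD (p.length + q)] := by
  simp [labels, List.mapIdx_append]

theorem length_labels (ψ : V → Option ℕ) (p : List V) : (labels q ψ p).length = p.length := by
  simp [labels]

theorem labels_congr {ψ ψ' : V → Option ℕ} {p : List V} (h : ∀ v ∈ p, ψ v = ψ' v) :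
    labels q ψ p = labels q ψ' p := by
  refine List.ext_getElem (by simp [labels]) fun i h1 h2 => ?_
  simp [labels, h]

theorem forall_mem_nbrPositions {ψ : V → Option ℕ} {p : List V} {v : V} {x : ℕ} :
    (∀ i ∈ nbrPositions G p v, (labels q ψ p).getD i 0 ≠ x) ↔
      ∀ i u, p[i]? = some u → G.Adj u v → (ψ u).getD (i + q) ≠ x := by
  simp only [nbrPositions, List.mem_filter, List.mem_range, decide_eq_true_eq]
  constructor
  · intro h i u hu ha
    have := h i ⟨(List.getElem?_eq_some_iff.1 hu).1, u, hu, ha⟩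
    simpa [labels, hu] using this
  · rintro h i ⟨-, u, hu, ha⟩
    simpa [labels, hu] using h i u hu ha

/-- A paid label never conflicts: it is at least `q`, so it differs from the free labels, and two
paid labels differ because their positions do. -/
theorem extendList_of_labelling {ψ : V → Option ℕ} (hψ : ∀ v x, ψ v = some x → x < q)
    (hG : ∀ u v, G.Adj u v → ψ u = ψ v → ψ v = none) {Q : List ℕ → ℕ → Prop} (vs : List V)
    {p : List V} {b b' : ℕ} (hb : b = b' + vs.countP (fun v => (ψ v).isNone))
    (hQ : Q (labels q ψ (p ++ vs)) b') : ExtendList G q p (labels q ψ p) vs b Q := by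
  induction vs generalizing p b with
  | nil => simpa [ExtendList, hb] using hQ
  | cons v vs ih =>
    refine ⟨(ψ v).getD (p.length + q), b' + vs.countP (fun v => (ψ v).isNone), ?_, ?_, ?_⟩
    · rw [length_labels, hb, List.countP_cons]
      cases hv : ψ v with
      | none => exact Or.inr ⟨rfl, by simp; omega⟩
      | some x => exact Or.inl ⟨hψ v x hv, by simp⟩
    · rw [forall_mem_nbrPositions]
      intro i u hu ha
      have hi := (List.getElem?_eq_some_iff.1 hu).1
      have := hG u v ha
      cases hv : ψ v with
      | none =>
        cases hu' : ψ u with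
        | none => simp; omega
        | some y => have := hψ u y hu'; simp; omega
      | some x =>
        have := hψ v x hv
        cases hu' : ψ u with
        | none => simp; omega
        | some y => simp_all
    · rw [← labels_snoc]
      exact ih rfl (by simpa using hQ)

theorem extendTree_of_labelling {ψ : V → Option ℕ} (hψ : ∀ v x, ψ v = some x → x < q)
    (hG : ∀ u v, G.Adj u v → ψ u = ψ v → ψ v = none) (t : SepTree V) {Q : ℕ → Prop}
    {p : List V} {b b' : ℕ} (hb : b = b' + t.verts.countP (fun v => (ψ v).isNone))
    (hQ : Q b') : ExtendTree G q p (labels q ψ p) t b Q := by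
  induction t generalizing p b b' Q with
  | leaf E => exact extendList_of_labelling hψ hG E hb hQ
  | node E l r ihl ihr =>
    simp only [verts, List.countP_append] at hb
    exact extendList_of_labelling hψ hG E (b' := b' +
        r.verts.countP (fun v => (ψ v).isNone) + l.verts.countP (fun v => (ψ v).isNone)) (by omega)
      (ihl rfl (ihr rfl hQ))

/-- The guesses are collected in `ψ` one vertex at a time; as vertices do not repeat, an update at
`v` leaves the labels of the branch before `v` intact. A paid guess is recorded as `none`, its
number being determined by the position. -/
theorem exists_of_extendList {Q : List ℕ → ℕ → Prop} (vs : List V) {p : List V}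
    (hnd : (p ++ vs).Nodup) {ψ : V → Option ℕ} {b : ℕ}
    (h : ExtendList G q p (labels q ψ p) vs b Q) :
    ∃ (ψ' : V → Option ℕ) (b' : ℕ), (∀ v, v ∉ vs → ψ' v = ψ v) ∧
      (∀ v ∈ vs, ∀ x, ψ' v = some x → x < q) ∧
      (∀ v ∈ vs, ∀ u ∈ p ++ vs, G.Adj u v → ψ' u = ψ' v → ψ' v = none) ∧
      Q (labels q ψ' (p ++ vs)) b' ∧ b = b' + vs.countP (fun v => (ψ' v).isNone) := by
  classical
  induction vs generalizing p ψ b with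
  | nil => exact ⟨ψ, b, by simp, by simp, by simp, by simpa [ExtendList] using h, by simp⟩
  | cons v vs ih =>
    obtain ⟨x, b₁, hx, hcheck, h⟩ := h
    rw [forall_mem_nbrPositions] at hcheck
    rw [length_labels] at hx
    have hvp : v ∉ p := fun hv => by
      have := List.nodup_append.1 hnd
      exact this.2.2 v hv v (by simp) rfl
    have hvvs : v ∉ vs := (List.nodup_cons.1 (List.nodup_append.1 hnd).2.1).1
    set ψ₁ := Function.update ψ v (if x < q then some x else none) with hψ₁
    have hψ₁v : ψ₁ v = if x < q then some x else none := by simp [ψ₁]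
    have hψ₁p : ∀ u ≠ v, ψ₁ u = ψ u := fun u hu => by simp [ψ₁, hu]
    have hlab : labels q ψ p ++ [x] = labels q ψ₁ (p ++ [v]) := by
      rw [labels_snoc, labels_congr (ψ' := ψ) fun u hu => hψ₁p u (by rintro rfl; exact hvp hu),
        hψ₁v]
      rcases hx with ⟨hx, -⟩ | ⟨hx, -⟩
      · simp [hx]
      · rw [if_neg (by omega), Option.getD_none, hx]
    rw [hlab] at h
    obtain ⟨ψ', b', hoff, hval, hadj, hQ, hcnt⟩ := ih (by simpa using hnd) h
    have hv' : ψ' v = if x < q then some x else none := (hoff v hvvs).trans hψ₁v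
    refine ⟨ψ', b', ?_, ?_, ?_, by simpa using hQ, ?_⟩
    · intro u hu
      simp only [List.mem_cons, not_or] at hu
      rw [hoff u hu.2, hψ₁p u hu.1]
    · intro u hu y hy
      rcases List.mem_cons.1 hu with rfl | hu
      · rw [hv'] at hy
        split_ifs at hy with hxq
        cases hy; exact hxq
      · exact hval u hu y hy
    · intro w hw u hu ha he
      rcases List.mem_cons.1 hw with rfl | hw
      · simp only [List.mem_append, List.mem_cons] at hu
        rcases hu with hu | rfl | hu
        · by_contra hne
          have hxq : x < q := by
            by_contra hxq
            exact hne (by simp [hv', hxq])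
          rw [if_pos hxq] at hv'
          obtain ⟨i, hi⟩ := List.mem_iff_getElem?.1 hu
          have huvs : u ∉ vs := fun h' =>
            (List.nodup_append.1 hnd).2.2 u hu u (by simp [h']) rfl
          have hu1 : ψ' u = ψ u := (hoff u huvs).trans (hψ₁p u ha.ne)
          refine hcheck i u hi ha ?_
          rw [← hu1, he, hv', Option.getD_some]
        · exact absurd ha (G.irrefl)
        -- Here `u` comes after `w`, so the pair was tested when `u` was read.
        · have := hadj u hu w (by simp) ha.symm he.symm
          rw [← he, this]
      · exact hadj w hw u (by simpa using hu) ha he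
    · rw [List.countP_cons, hv']
      rcases hx with ⟨hx, rfl⟩ | ⟨hx, rfl⟩
      · simp [hx, hcnt]
      · simp [hcnt, Nat.add_assoc, hx]

/-- Labels in the right subtree are never compared with those in the left one, and separation says
that no edge requires it. -/
theorem exists_of_extendTree {β : ℝ} (t : SepTree V) (hsep : t.Separates G β) {Q : ℕ → Prop}
    {p : List V} (hnd : (p ++ t.verts).Nodup) {ψ : V → Option ℕ} {b : ℕ}
    (h : ExtendTree G q p (labels q ψ p) t b Q) :
    ∃ (ψ' : V → Option ℕ) (b' : ℕ), (∀ v, v ∉ t.verts → ψ' v = ψ v) ∧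
      (∀ v ∈ t.verts, ∀ x, ψ' v = some x → x < q) ∧
      (∀ v ∈ t.verts, ∀ u ∈ p ++ t.verts, G.Adj u v → ψ' u = ψ' v → ψ' v = none) ∧
      Q b' ∧ b = b' + t.verts.countP (fun v => (ψ' v).isNone) := by
  induction t generalizing p ψ b Q with
  | leaf E => exact exists_of_extendList E hnd h
  | node E l r ihl ihr =>
    obtain ⟨-, -, -, -, hlr, hl, hr⟩ := hsep
    simp only [verts] at hnd ⊢
    have hnd1 : (p ++ E).Nodup := hnd.sublist (by simp)
    have hndl : (p ++ E ++ l.verts).Nodup := hnd.sublist (by simp)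
    have hndr : (p ++ E ++ r.verts).Nodup := hnd.sublist (by simp)
    have hdl : ∀ v ∈ p ++ E, v ∉ l.verts := fun v hv hv' =>
      (List.nodup_append.1 hndl).2.2 v hv v hv' rfl
    have hdr : ∀ v ∈ p ++ E ++ l.verts, v ∉ r.verts := fun v hv hv' =>
      (List.nodup_append.1 (by simpa using hnd : ((p ++ E ++ l.verts) ++ r.verts).Nodup)).2.2
        v hv v hv' rfl
    obtain ⟨ψ₁, b₁, hoff₁, hval₁, hadj₁, h₁, hc₁⟩ := exists_of_extendList E hnd1 h
    obtain ⟨ψ₂, b₂, hoff₂, hval₂, hadj₂, h₂, hc₂⟩ := ihl hl hndl h₁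
    -- The right subtree starts from the labels of the branch, which labelling the left subtree has
    -- not changed.
    rw [labels_congr fun v hv => (hoff₂ v (hdl v hv)).symm] at h₂
    obtain ⟨ψ₃, b₃, hoff₃, hval₃, hadj₃, h₃, hc₃⟩ := ihr hr hndr h₂
    have e32 : ∀ v ∈ p ++ E ++ l.verts, ψ₃ v = ψ₂ v := fun v hv => hoff₃ v (hdr v hv)
    have e31 : ∀ v ∈ p ++ E, ψ₃ v = ψ₁ v := fun v hv =>
      (e32 v (List.mem_append_left _ hv)).trans (hoff₂ v (hdl v hv))
    have hadjE : ∀ v ∈ E, ∀ u ∈ p ++ E, G.Adj u v → ψ₃ u = ψ₃ v → ψ₃ v = none := by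
      intro v hv u hu ha he
      rw [e31 u hu, e31 v (by simp [hv])] at he
      rw [e31 v (by simp [hv])]
      exact hadj₁ v hv u hu ha he
    have hadjl : ∀ v ∈ l.verts, ∀ u ∈ p ++ E ++ l.verts, G.Adj u v → ψ₃ u = ψ₃ v →
        ψ₃ v = none := by
      intro v hv u hu ha he
      have hv' : v ∈ p ++ E ++ l.verts := by simp [hv]
      rw [e32 u hu, e32 v hv'] at he
      rw [e32 v hv']
      exact hadj₂ v hv u hu ha he
    refine ⟨ψ₃, b₃, ?_, ?_, ?_, h₃, ?_⟩
    · intro v hv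
      simp only [List.mem_append, not_or] at hv
      rw [hoff₃ v hv.2, hoff₂ v hv.1.2, hoff₁ v hv.1.1]
    · intro v hv x hx
      simp only [List.mem_append] at hv
      rcases hv with (hv | hv) | hv
      · exact hval₁ v hv x (by rw [← e31 v (by simp [hv])]; exact hx)
      · exact hval₂ v hv x (by rw [← e32 v (by simp [hv])]; exact hx)
      · exact hval₃ v hv x hx
    · intro v hv u hu ha he
      have hswap : ψ₃ u = none → ψ₃ v = none := fun h => he ▸ h
      simp only [List.mem_append] at hv hu
      rcases hv with (hv | hv) | hv
      · rcases hu with hu | (hu | hu) | hu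
        · exact hadjE v hv u (by simp [hu]) ha he
        · exact hadjE v hv u (by simp [hu]) ha he
        · exact hswap (hadjl u hu v (by simp [hv]) ha.symm he.symm)
        · exact hswap (hadj₃ u hu v (by simp [hv]) ha.symm he.symm)
      · rcases hu with hu | (hu | hu) | hu
        · exact hadjl v hv u (by simp [hu]) ha he
        · exact hadjl v hv u (by simp [hu]) ha he
        · exact hadjl v hv u (by simp [hu]) ha he
        · exact absurd ha.symm (hlr v hv u hu)
      · rcases hu with hu | (hu | hu) | hu
        · exact hadj₃ v hv u (by simp [hu]) ha he
        · exact hadj₃ v hv u (by simp [hu]) ha he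
        · exact absurd ha (hlr u hu v hv)
        · exact hadj₃ v hv u (by simp [hu]) ha he
    · have e1 : E.countP (fun v => (ψ₁ v).isNone) = E.countP (fun v => (ψ₃ v).isNone) :=
        List.countP_congr fun v hv => by rw [e31 v (by simp [hv])]
      have e2 : l.verts.countP (fun v => (ψ₂ v).isNone) =
          l.verts.countP (fun v => (ψ₃ v).isNone) :=
        List.countP_congr fun v hv => by rw [e32 v (by simp [hv])]
      rw [List.countP_append, List.countP_append, hc₁, hc₂, hc₃, e1, e2]
      omega

/-- The trivial final condition lets budget be left over, hence `≤ k` rather than equality. -/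
theorem extendTree_iff {N : ℕ} {G : SimpleGraph (Fin N)} {c : ℝ} {t : SepTree (Fin N)}
    (ht : t.IsSeparatingTree G c) (k : ℕ) :
    ExtendTree G q [] [] t k (fun _ => True) ↔
      ∃ ψ : Fin N → Option ℕ, (∀ v x, ψ v = some x → x < q) ∧
        (∀ u v, G.Adj u v → ψ u = ψ v → ψ v = none) ∧
        (Finset.univ.filter (fun v => ψ v = none)).card ≤ k := by
  obtain ⟨hnd, hall, hsep⟩ := ht
  have hcard (ψ : Fin N → Option ℕ) : (Finset.univ.filter (fun v => ψ v = none)).card =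
      t.verts.countP (fun v => (ψ v).isNone) := by
    rw [List.countP_eq_length_filter, ← List.toFinset_card_of_nodup (hnd.filter _)]
    congr 1
    ext v
    simp [hall]
  simp only [hcard]
  constructor
  · intro h
    obtain ⟨ψ, b', -, hval, hadj, -, hc⟩ :=
      exists_of_extendTree t hsep (p := []) (ψ := fun _ => none) hnd h
    exact ⟨ψ, fun v => hval v (hall v), fun u v => hadj v (hall v) u (hall u), by omega⟩
  · rintro ⟨ψ, hval, hadj, hc⟩
    exact extendTree_of_labelling hval hadj t (p := []) (Nat.sub_add_cancel hc).symm trivial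

/-- Budget `0` leaves no paid vertices, so the labels form a proper colouring. -/
theorem extendTree_three_iff {N : ℕ} {G : SimpleGraph (Fin N)} {c : ℝ} {t : SepTree (Fin N)}
    (ht : t.IsSeparatingTree G c) :
    ExtendTree G 3 [] [] t 0 (fun _ => True) ↔ G.Colorable 3 := by
  rw [extendTree_iff ht]
  constructor
  · rintro ⟨ψ, hval, hadj, hc⟩
    have hsome : ∀ v, ψ v ≠ none := fun v hv => by
      have : v ∈ Finset.univ.filter (fun v => ψ v = none) := by simp [hv]
      rw [Finset.card_eq_zero.1 (Nat.le_zero.1 hc)] at this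
      simp at this
    choose φ hφ using fun v => Option.ne_none_iff_exists'.1 (hsome v)
    refine ⟨SimpleGraph.Coloring.mk (fun v => (⟨φ v, hval v _ (hφ v)⟩ : Fin 3)) ?_⟩
    intro u v ha he
    have : φ u = φ v := congrArg Fin.val he
    exact hsome v (hadj u v ha (by rw [hφ, hφ, this]))
  · rintro ⟨C⟩
    refine ⟨fun v => some (C v), ?_, ?_, by simp⟩
    · intro v x hx
      cases hx; exact (C v).2
    · intro u v ha he
      exact absurd (Fin.ext (Option.some.inj he)) (C.valid ha)

/-- With the single free label `0`, two free vertices cannot be adjacent, so the paid ones meet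
every edge. -/
theorem extendTree_one_iff {N : ℕ} {G : SimpleGraph (Fin N)} {c : ℝ} {t : SepTree (Fin N)}
    (ht : t.IsSeparatingTree G c) (k : ℕ) :
    ExtendTree G 1 [] [] t k (fun _ => True) ↔
      ∃ C : Finset (Fin N), G.IsVertexCover (C : Set (Fin N)) ∧ C.card ≤ k := by
  rw [extendTree_iff ht]
  constructor
  · rintro ⟨ψ, hval, hadj, hc⟩
    refine ⟨_, ?_, hc⟩
    intro u v ha
    by_contra h
    simp only [Finset.coe_filter, Finset.mem_univ, true_and, Set.mem_ofPred_eq, not_or] at h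
    obtain ⟨x, hx⟩ := Option.ne_none_iff_exists'.1 h.1
    obtain ⟨y, hy⟩ := Option.ne_none_iff_exists'.1 h.2
    have hx' := hval u x hx
    have hy' := hval v y hy
    exact h.2 (hadj u v ha (by rw [hx, hy]; congr 1; omega))
  · rintro ⟨C, hC, hc⟩
    refine ⟨fun v => if v ∈ C then none else some 0, ?_, ?_, by simpa using hc⟩
    · intro v x hx
      dsimp only at hx
      split_ifs at hx
      cases hx; exact one_pos
    · intro u v ha he
      dsimp only at he ⊢
      rcases hC ha with h | h
      · rw [← he, if_pos (by simpa using h)]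
      · exact if_pos (by simpa using h)

end Labels

/-! ## The length of branches -/

section Height

variable {V : Type} {G : SimpleGraph V}

/-- The geometric series is summed by induction: `21` satisfies `2√2 + 1 + 21√(2/3) ≤ 21`. The `1`
is the stack entry of an inner node, absorbed since `√m ≥ 1`; the leaf bound `β` enters once. -/
theorem height_le {β : ℝ} (t : SepTree V) (h : t.Separates G β) :
    (t.height : ℝ) ≤ β + 21 * √(t.verts.length : ℝ) := by
  induction t with
  | leaf E =>
    have : (E.length : ℝ) ≤ β := h
    have := Real.sqrt_nonneg (E.length : ℝ)
    simp only [height, verts]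
    linarith
  | node E l r ihl ihr =>
    obtain ⟨hm, hE, hl, hr, -, hsl, hsr⟩ := h
    generalize hmm : ((node E l r).verts.length) = m at *
    have hm1 : (1 : ℝ) ≤ √(m : ℝ) := by
      rw [Real.one_le_sqrt]; exact_mod_cast hm
    -- Decimal bounds for `√2` and, below, for `√(2/3)`: they give `2.8286 + 1 + 21 * 0.8166 ≤ 21`.
    have h2 : √(2 : ℝ) ≤ 1.4143 := by
      rw [Real.sqrt_le_left (by norm_num)]; norm_num
    have hE' : (E.length : ℝ) ≤ 2.8286 * √(m : ℝ) :=
      hE.trans (mul_le_mul_of_nonneg_right (by linarith) (by linarith))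
    have hsub : ∀ x : ℕ, (x : ℝ) ≤ 2 * m / 3 → √(x : ℝ) ≤ 0.8166 * √(m : ℝ) := by
      intro x hx
      rw [Real.sqrt_le_left (by positivity), mul_pow, Real.sq_sqrt (by positivity)]
      have : (0 : ℝ) ≤ m := by positivity
      linarith
    have h3 := ihl hsl
    have h4 := ihr hsr
    have h5 := hsub _ hl
    have h6 := hsub _ hr
    simp only [height, Nat.cast_add, Nat.cast_one, Nat.cast_max]
    rcases max_cases (l.height : ℝ) (r.height : ℝ) with ⟨h, -⟩ | ⟨h, -⟩ <;> rw [h] <;> linarith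

theorem length_le_encodeVerts (vs p : List V) : vs.length ≤ (encodeVerts G p vs).length := by
  induction vs generalizing p with
  | nil => simp
  | cons v vs ih =>
    have := ih (p ++ [v])
    simp only [encodeVerts, List.length_cons, List.length_append]
    omega

theorem length_verts_le_encode (t : SepTree V) (p : List V) :
    t.verts.length ≤ (encode G p t).length := by
  induction t generalizing p with
  | leaf E =>
    have := length_le_encodeVerts (G := G) E p
    simp only [verts, encode, List.length_cons]
    omega
  | node E l r ihl ihr =>
    have := length_le_encodeVerts (G := G) E p
    have := ihl (p ++ E)
    have := ihr (p ++ E)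
    simp only [verts, encode, List.length_cons, List.length_append]
    omega

theorem IsSeparatingTree.height_le {N : ℕ} {G : SimpleGraph (Fin N)} {c : ℝ}
    {t : SepTree (Fin N)} (ht : t.IsSeparatingTree G c) {n r : ℕ} (hn : (encode G [] t).length ≤ n)
    (hr : n ≤ r * r) : t.height ≤ (⌈c⌉₊ + 21) * r := by
  obtain ⟨hnd, hall, hsep⟩ := ht
  have hN : t.verts.length = N := by
    rw [← List.toFinset_card_of_nodup hnd, (Finset.eq_univ_iff_forall.2 fun v => by
      simpa using hall v : t.verts.toFinset = Finset.univ), Finset.card_fin]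
  have h := SepTree.height_le t hsep
  have hNr : √(N : ℝ) ≤ r := by
    rw [Real.sqrt_le_left (by positivity)]
    -- Every vertex contributes at least one entry to the code.
    have : N ≤ r * r := (hN ▸ length_verts_le_encode t []).trans (hn.trans hr)
    rw [pow_two]
    exact_mod_cast this
  rw [hN] at h
  have hc : c * √(N : ℝ) ≤ ⌈c⌉₊ * √(N : ℝ) :=
    mul_le_mul_of_nonneg_right (Nat.le_ceil c) (Real.sqrt_nonneg _)
  have hK : ((⌈c⌉₊ : ℝ) + 21) * √(N : ℝ) ≤ (⌈c⌉₊ + 21) * r :=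
    mul_le_mul_of_nonneg_left hNr (by positivity)
  have : (t.height : ℝ) ≤ ((⌈c⌉₊ + 21) * r : ℕ) := by push_cast; linarith
  exact_mod_cast this

end Height

end SepTree

/-! ### Asymptotic bounds and membership in `NTISP`. -/

namespace SepTree

open RegInstr

/-- The bound on the addresses. -/
def addressBound (K n : ℕ) : ℕ := 2 * (K * (Nat.sqrt (2 * n) + 1)) + 12

theorem addressBound_isBigO (K : ℕ) :
    (fun n => (addressBound K n : ℝ)) =O[atTop] fun n : ℕ => √(n : ℝ) := by
  refine IsBigO.of_bound (6 * K + 12) ?_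
  filter_upwards [eventually_ge_atTop 1] with n hn
  have h1 : (1 : ℝ) ≤ √(n : ℝ) := by rw [Real.one_le_sqrt]; exact_mod_cast hn
  have h2 : (Nat.sqrt (2 * n) : ℝ) ≤ 2 * √(n : ℝ) := by
    refine Real.nat_sqrt_le_real_sqrt.trans ?_
    rw [Real.sqrt_le_left (by positivity), mul_pow, Real.sq_sqrt (by positivity)]
    push_cast
    linarith [(Nat.cast_nonneg n : (0 : ℝ) ≤ n)]
  rw [Real.norm_of_nonneg (by positivity), Real.norm_of_nonneg (by positivity)]
  simp only [addressBound]
  push_cast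
  have : (K : ℝ) * (Nat.sqrt (2 * n) + 1) ≤ K * (3 * √(n : ℝ)) :=
    mul_le_mul_of_nonneg_left (by linarith) (by positivity)
  linarith

theorem timeBound_isBigO (W q : ℕ) :
    (fun n : ℕ => ((W * ((3 * q + 27) * n + 10) : ℕ) : ℝ)) =O[atTop] fun n : ℕ => (n : ℝ) := by
  refine IsBigO.of_bound (W * (3 * q + 37)) ?_
  filter_upwards [eventually_ge_atTop 1] with n hn
  rw [Real.norm_of_nonneg (by positivity), Real.norm_of_nonneg (by positivity), mul_assoc]
  have h1 : (1 : ℝ) ≤ n := by exact_mod_cast hn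
  push_cast
  refine mul_le_mul_of_nonneg_left ?_ (by positivity)
  linarith

theorem contentBound_isBigO (K q : ℕ) :
    (fun n : ℕ => ((addressBound K n + q + n + 1 : ℕ) : ℝ)) =O[atTop]
      fun n : ℕ => max (n : ℝ) (√(n : ℝ)) := by
  have h1 : (fun n : ℕ => √(n : ℝ)) =O[atTop] fun n : ℕ => max (n : ℝ) (√(n : ℝ)) := by
    refine IsBigO.of_bound 1 (Eventually.of_forall fun n => ?_)
    rw [one_mul, Real.norm_of_nonneg (by positivity), Real.norm_of_nonneg (by positivity)]
    exact le_max_right _ _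
  have h2 : (fun n : ℕ => ((q + n + 1 : ℕ) : ℝ)) =O[atTop]
      fun n : ℕ => max (n : ℝ) (√(n : ℝ)) := by
    refine IsBigO.of_bound (q + 2) ?_
    filter_upwards [eventually_ge_atTop 1] with n hn
    rw [Real.norm_of_nonneg (by positivity), Real.norm_of_nonneg (by positivity)]
    have h1 : (1 : ℝ) ≤ n := by exact_mod_cast hn
    refine le_trans ?_ (mul_le_mul_of_nonneg_left (le_max_left _ _) (by positivity))
    push_cast
    nlinarith [(Nat.cast_nonneg q : (0 : ℝ) ≤ q)]
  refine (((addressBound_isBigO K).trans h1).add h2).congr_left fun n => ?_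
  push_cast
  ring

/-- The program on the input `f`. -/
def setup (a b : RegInstr 12) (ha : a ≠ accept) (hb : b ≠ accept) (q K : ℕ) {n : ℕ}
    (f : Fin n → Fin n) : Setup 12 where
  body := program a b q K
  accept_notMem := by simp [program, ha.symm, hb.symm]
  width := ((program a b q K ++ [accept]).map size).sum
  size_le x hx := List.le_sum_of_mem (List.mem_map_of_mem hx)
  n := n
  f := f
  s := addressBound K n
  m := addressBound K n + q + n + 1
  le_s := by simp [addressBound]
  le_m := by omega

/-- A problem on separating trees that asks for labellings is in `NTISP(n, √n)`, if the
instructions `a` and `b` read what precedes the separating tree representation. Here `D f G t k`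
means that `f` codes the graph `G` with the separating tree `t` and the budget `k`. -/
theorem mem_NTISP {a b : RegInstr 12} (ha : a ≠ accept) (hb : b ≠ accept) {q : ℕ} (hq : 0 < q)
    (c : ℝ) {P : UnaryProblem}
    (D : ∀ {n N : ℕ}, (Fin n → Fin n) → SimpleGraph (Fin N) → SepTree (Fin N) → ℕ → Prop)
    (hI : ∀ {n : ℕ} {f : Fin n → Fin n}, P.IsInstance f →
      ∃ (N : ℕ) (G : SimpleGraph (Fin N)) (t : SepTree (Fin N)) (k : ℕ), D f G t k)
    (hY : ∀ {n : ℕ} {f : Fin n → Fin n}, P.IsYes f ↔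
      ∃ (N : ℕ) (G : SimpleGraph (Fin N)) (t : SepTree (Fin N)) (k : ℕ), D f G t k ∧
        ExtendTree G q [] [] t k (fun _ => True)) (ptr : ℕ)
    (hD : ∀ {n N : ℕ} {f : Fin n → Fin n} {G : SimpleGraph (Fin N)} {t : SepTree (Fin N)} {k : ℕ},
      D f G t k → t.IsSeparatingTree G c ∧
        (List.ofFn (fun i => (f i : ℕ))).drop ptr = encode G [] t ∧
        ∀ K ρ base T Q, Regs q 0 0 0 base base (ρ 5) (ρ 10) ρ →
          (∀ ρ', Regs q ptr 0 k base base (ρ' 5) (ρ' 10) ρ' →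
            RegInstr.Runs (setup a b ha hb q K f) 12 ρ' (fun _ => 0) T Q) →
          RegInstr.Runs (setup a b ha hb q K f) 10 ρ (fun _ => 0) (T + 2) Q) :
    P ∈ NTISP (fun n => (n : ℝ)) (fun n => √(n : ℝ)) := by
  obtain ⟨K, hK⟩ : ∃ K, K = ⌈c⌉₊ + 21 := ⟨_, rfl⟩
  -- `W` depends on the program alone and not on `n`, so it is a constant factor in the time.
  obtain ⟨W, hW⟩ : ∃ W, W = ((program a b q K ++ [accept]).map size).sum := ⟨_, rfl⟩
  refine ⟨toNRAM (program a b q K) (by simp [program, ha.symm, hb.symm]),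
    fun n => W * ((3 * q + 27) * n + 10), addressBound K,
    fun n => addressBound K n + q + n + 1, timeBound_isBigO W q, addressBound_isBigO K,
    contentBound_isBigO K q, ?_⟩
  · intro n f hf
    have key {N : ℕ} {G : SimpleGraph (Fin N)} {t : SepTree (Fin N)} {k : ℕ} (h : D f G t k) :
        (toNRAM (program a b q K) (setup a b ha hb q K f).accept_notMem).RunsInTime f
          (W * ((3 * q + 27) * n + 10)) ∧
        (toNRAM (program a b q K) (setup a b ha hb q K f).accept_notMem).RunsInSpace f
          (addressBound K n) (addressBound K n + q + n + 1) ∧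
        ((toNRAM (program a b q K) (setup a b ha hb q K f).accept_notMem).Accepts f ↔
          ExtendTree G q [] [] t k (fun _ => True)) := by
      obtain ⟨ht, hin, hinit⟩ := hD h
      have hlen : (encode G [] t).length ≤ n := by
        rw [← hin, List.length_drop, List.length_ofFn]
        exact Nat.sub_le _ _
      rw [hW]
      exact (runs_program (S := setup a b ha hb q K f) rfl (Nat.le_of_eq (by
        simp only [setup])) hq (by omega) le_rfl t
        (fun r hr => hK ▸ ht.height_le hlen hr) hin (hinit K)).bounds
    obtain ⟨N, G, t, k, h⟩ := hI hf
    refine ⟨(key h).1, (key h).2.1, ?_⟩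
    rw [hY]
    constructor
    · exact fun hacc => ⟨N, G, t, k, h, (key h).2.2.1 hacc⟩
    -- The representation witnessing "yes" may differ from the one witnessing that `f` is an
    -- instance. As `key` applies to each, uniqueness of decoding is not needed.
    · rintro ⟨N', G', t', k', h', hyes⟩
      exact (key h').2.2.2 hyes

end SepTree

open SepTree RegInstr in
theorem mainTheorem5 (c : ℝ) :
    sepTreePlanar3Col c ∈ NTISP (fun n => (n : ℝ)) (fun n => √(n : ℝ)) ∧
    sepTreePlanarVertexCover c ∈ NTISP (fun n => (n : ℝ)) (fun n => √(n : ℝ)) := by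
  constructor
  -- Nothing precedes the representation: both instructions write `0` where `0` already stands, and
  -- the budget is `0`.
  · refine mem_NTISP (a := .zero 2) (b := .zero 0) (by simp) (by simp) (q := 3) (by norm_num) c
      (fun f G t k => k = 0 ∧ IsPlanar G ∧ t.IsSeparatingTree G c ∧ IsCodedBy f (t.encode G []))
      ?_ ?_ 0 ?_
    · rintro n f ⟨N, G, t, h⟩
      exact ⟨N, G, t, 0, rfl, h⟩
    · intro n f
      constructor
      · rintro ⟨N, G, t, hG, ht, hf, h⟩
        exact ⟨N, G, t, 0, ⟨rfl, hG, ht, hf⟩, (extendTree_three_iff ht).2 h⟩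
      · rintro ⟨N, G, t, k, ⟨rfl, hG, ht, hf⟩, h⟩
        exact ⟨N, G, t, hG, ht, hf, (extendTree_three_iff ht).1 h⟩
    · rintro n N f G t k ⟨rfl, -, ht, hf⟩
      refine ⟨ht, hf, fun K ρ base T Q hρ hk => ?_⟩
      obtain ⟨h0, h1, h2, h3, h4, h5, h9, h10, h11⟩ := hρ
      refine .zero (instr_at rfl rfl) (.zero (instr_at rfl rfl) (hk _ ?_))
      constructor <;> simp [*]
  -- The first entry `k` is read into the budget, and the input position moves past it.
  · refine mem_NTISP (a := .query 2 0) (b := .add 0 1) (by simp) (by simp) (q := 1) one_pos c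
      (fun {_ N} f G t k => k ≤ N ∧ IsPlanar G ∧ t.IsSeparatingTree G c ∧
        IsCodedBy f (k :: t.encode G [])) ?_ ?_ 1 ?_
    · exact id
    · intro n f
      constructor
      · rintro ⟨N, G, t, k, hk, hG, ht, hf, h⟩
        exact ⟨N, G, t, k, ⟨hk, hG, ht, hf⟩, (extendTree_one_iff ht k).2 h⟩
      · rintro ⟨N, G, t, k, ⟨hk, hG, ht, hf⟩, h⟩
        exact ⟨N, G, t, k, hk, hG, ht, hf, (extendTree_one_iff ht k).1 h⟩
    · rintro n N f G t k ⟨-, -, ht, hf⟩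
      refine ⟨ht, by rw [hf]; rfl, fun K ρ base T Q hρ hk => ?_⟩
      obtain ⟨h0, h1, h2, h3, h4, h5, h9, h10, h11⟩ := hρ
      obtain ⟨hp, hf0, -⟩ := input_cons (S := setup (.query 2 0) (.add 0 1) (by simp) (by simp)
        1 K f) (ptr := 0) hf
      refine .query (instr_at rfl rfl) (by rw [h0]; exact hp) (.add (instr_at rfl rfl)
        (by simp [h0, setup]) (hk _ ?_))
      constructor <;> simp [*]
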